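/- Let $n_u,n_b,T\ge 0$ be integers, $n=n_u+n_b$, and write vectors of $\mathbb R^n$ as $\mathbf y=[\mathbf u^T,\mathbf b^T]^T$ with $\mathbf u\in\mathbb R^{n_u}$ (upper series) and $\mathbf b\in\mathbb R^{n_b}$ (bottom series). Let $\mathbf A\in\mathbb R^{n_u\times n_b}$ (the aggregation matrix), let $\boldsymbol\Psi_0\in\mathbb R^{n\times n}$ be positive definite and let $\nu_0>n-1$ be real. Assume that the error covariance matrix has the Inverse-Wishart prior $\mathbf W\sim\operatorname{IW}(\boldsymbol\Psi_0,\nu_0)$, i.e. its density on the positive definite matrices is proportional to $|\mathbf W|^{-(\nu_0+n+1)/2}\exp\left(-\tfrac12\operatorname{tr}(\boldsymbol\Psi_0\mathbf W^{-1})\right)$, and that, conditionally on $\mathbf W$, the residuals $\mathbf r_1,\dots,\mathbf r_T$ are IID $\mathcal N(\mathbf 0,\mathbf W)$. Let $\mathbf R=[\mathbf r_1\,\dots\,\mathbf r_T]\in\mathbb R^{n\times T}$ be the matrix of observed residuals, let $\pi(\mathbf W\mid\mathbf R)$ be the posterior of $\mathbf W$ given by Bayes' rule, let $\widehat{\mathbf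 y}=[\widehat{\mathbf u}^T,\widehat{\mathbf b}^T]^T\in\mathbb R^n$ be the point forecast, and let $[\widehat{\mathbf U}^T,\widehat{\mathbf B}^T]^T$ be a random vector distributed as the posterior predictive distribution, which has density $\widehat\pi(\mathbf y\mid\mathbf R)=\int\mathcal N(\mathbf y;\widehat{\mathbf y},\mathbf W)\,\pi(\mathbf W\mid\mathbf R)\,d\mathbf W$. Set $\nu'=\nu_0+T$ and $$\boldsymbol\Psi'=\boldsymbol\Psi_0+\mathbf R\mathbf R^T=\begin{bmatrix}\boldsymbol\Psi'_U&\boldsymbol\Psi'_{UB}\\ {\boldsymbol\Psi'_{UB}}^T&\boldsymbol\Psi'_B\end{bmatrix},\qquad \mathbf d=\mathbf A\widehat{\mathbf b}-\widehat{\mathbf u},\qquad \mathbf Q=\boldsymbol\Psi'_U-\boldsymbol\Psi'_{UB}\mathbf A^T-\mathbf A{\boldsymbol\Psi'_{UB}}^T+\mathbf A\boldsymbol\Psi'_B\mathbf A^T .$$ Then the posterior predictive distribution is a well-defined probability distribution, and the distribution reconciled via conditioning, $\widetilde{\mathbf B}\sim\widehat{\mathbf B}\mid(\widehat{\mathbf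 U}-\mathbf A\widehat{\mathbf B}=\mathbf 0)$, is the multivariate $t$-distribution $$\widetilde{\mathbf B}\sim\operatorname{mt}(\widetilde{\mathbf b},\widetilde{\boldsymbol\Sigma}_B,\widetilde\nu)$$ with location, scale matrix and degrees of freedom $$\widetilde{\mathbf b}=\widehat{\mathbf b}+\left({\boldsymbol\Psi'_{UB}}^T-\boldsymbol\Psi'_B\mathbf A^T\right)\mathbf Q^{-1}\mathbf d,$$ $$\widetilde{\boldsymbol\Sigma}_B=C\left[\boldsymbol\Psi'_B-\left({\boldsymbol\Psi'_{UB}}^T-\boldsymbol\Psi'_B\mathbf A^T\right)\mathbf Q^{-1}\left({\boldsymbol\Psi'_{UB}}^T-\boldsymbol\Psi'_B\mathbf A^T\right)^T\right],\qquad \widetilde\nu=\nu'-n_b+1,\qquad C=\frac{1+\mathbf d^T\mathbf Q^{-1}\mathbf d}{\widetilde\nu},$$ where $\mathbf Q$ and $\widetilde{\boldsymbol\Sigma}_B$ are positive definite and $\widetilde\nu>0$. Here the conditional distribution given the null event is the value at $\mathbf 0$ of the weakly continuous regular conditional distribution of $\widehat{\mathbf B}$ given $\widehat{\mathbf U}-\mathbf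 A\widehat{\mathbf B}$; likewise, it is the distribution with density proportional to $\mathbf b\mapsto\widehat\pi\left([(\mathbf A\mathbf b)^T,\mathbf b^T]^T\mid\mathbf R\right)$. -/

import Mathlib

open MeasureTheory ProbabilityTheory Matrix
open scoped ENNReal

namespace HierRec

/-- Density at `x` of the Gaussian distribution `N(μ, S)` on `ℝ^ι`, for `S` positive definite. -/
noncomputable def gaussianDensity {ι : Type*} [Fintype ι] [DecidableEq ι]
    (μ : ι → ℝ) (S : Matrix ι ι ℝ) (x : ι → ℝ) : ℝ :=
  (2 * Real.pi) ^ (-(Fintype.card ι : ℝ) / 2) * S.det ^ (-(1 : ℝ) / 2) *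
    Real.exp (-((x - μ) ⬝ᵥ (S⁻¹ *ᵥ (x - μ))) / 2)

/-- Density at `x` of the multivariate t-distribution `mt(μ, S, ν)` on `ℝ^ι` with location `μ`,
positive definite scale matrix `S` and `ν > 0` degrees of freedom. -/
noncomputable def multivariateTDensity {ι : Type*} [Fintype ι] [DecidableEq ι]
    (μ : ι → ℝ) (S : Matrix ι ι ℝ) (ν : ℝ) (x : ι → ℝ) : ℝ :=
  Real.Gamma ((ν + Fintype.card ι) / 2) /
      (Real.Gamma (ν / 2) * (ν * Real.pi) ^ ((Fintype.card ι : ℝ) / 2) * S.det ^ ((1 : ℝ) / 2)) *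
    (1 + (x - μ) ⬝ᵥ (S⁻¹ *ᵥ (x - μ)) / ν) ^ (-(ν + Fintype.card ι) / 2)

/-- The multivariate t-distribution `mt(μ, S, ν)`. -/
noncomputable def multivariateT {ι : Type*} [Fintype ι] [DecidableEq ι]
    (μ : ι → ℝ) (S : Matrix ι ι ℝ) (ν : ℝ) : Measure (ι → ℝ) :=
  volume.withDensity fun x => ENNReal.ofReal (multivariateTDensity μ S ν x)

/-- The symmetric matrix whose entries `(i, j)` and `(j, i)` are the coordinate `s(i, j)`. -/
def symMatrix {ι : Type*} (x : Sym2 ι → ℝ) : Matrix ι ι ℝ :=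
  Matrix.of fun i j => x s(i, j)

/-- The product σ-algebra on matrices. -/
instance instMeasurableSpaceMatrix (m n : Type*) : MeasurableSpace (Matrix m n ℝ) :=
  MeasurableSpace.pi (X := fun _ : m => n → ℝ)

/-- Lebesgue measure `∏_{i ≤ j} dW_ij` on the symmetric matrices, as a measure on all matrices. -/
noncomputable def lebesgueSym (ι : Type*) [Fintype ι] [DecidableEq ι] :
    Measure (Matrix ι ι ℝ) :=
  (volume : Measure (Sym2 ι → ℝ)).map symMatrix

/-- The multivariate gamma function
`Γ_p(a) = π^(p(p-1)/4) Γ(a) Γ(a - 1/2) ⋯ Γ(a - (p-1)/2)`. -/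
noncomputable def multivariateGamma (p : ℕ) (a : ℝ) : ℝ :=
  Real.pi ^ ((p : ℝ) * ((p : ℝ) - 1) / 4) * ∏ k ∈ Finset.range p, Real.Gamma (a - (k : ℝ) / 2)

open Classical in
/-- Density at `W` of the Inverse-Wishart distribution `IW(Ψ, ν)` with respect to `lebesgueSym`;
it vanishes off the positive definite matrices. -/
noncomputable def invWishartDensity {ι : Type*} [Fintype ι] [DecidableEq ι]
    (Ψ : Matrix ι ι ℝ) (ν : ℝ) (W : Matrix ι ι ℝ) : ℝ :=
  if W.PosDef then
    Ψ.det ^ (ν / 2) /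
        (2 ^ (ν * Fintype.card ι / 2) * multivariateGamma (Fintype.card ι) (ν / 2)) *
      W.det ^ (-(ν + Fintype.card ι + 1) / 2) * Real.exp (-(Ψ * W⁻¹).trace / 2)
  else 0

/-- The Inverse-Wishart distribution `IW(Ψ, ν)`, for `Ψ` positive definite and `ν > p - 1`, where
`p` is the size of the matrices. -/
noncomputable def invWishart {ι : Type*} [Fintype ι] [DecidableEq ι]
    (Ψ : Matrix ι ι ℝ) (ν : ℝ) : Measure (Matrix ι ι ℝ) :=
  (lebesgueSym ι).withDensity fun W => ENNReal.ofReal (invWishartDensity Ψ ν W)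

/-- The likelihood `π(R | W)` of a residual matrix `R` whose columns are, given `W`, independent
with distribution `N(0, W)`. -/
noncomputable def likelihood {ι : Type*} [Fintype ι] [DecidableEq ι] {T : ℕ}
    (R : Matrix ι (Fin T) ℝ) (W : Matrix ι ι ℝ) : ℝ :=
  ∏ j : Fin T, gaussianDensity 0 W (fun i => R i j)

/-- The posterior distribution of `W` given `R`, by Bayes' rule
`π(W | R) = π(W) π(R | W) / π(R)`, where `π(R) = ∫ π(R | W) dπ(W)`. -/
noncomputable def bayesPosterior {ι : Type*} [Fintype ι] [DecidableEq ι] {T : ℕ}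
    (prior : Measure (Matrix ι ι ℝ)) (R : Matrix ι (Fin T) ℝ) : Measure (Matrix ι ι ℝ) :=
  (∫⁻ W, ENNReal.ofReal (likelihood R W) ∂prior)⁻¹ •
    prior.withDensity fun W => ENNReal.ofReal (likelihood R W)

/-- The predictive density `y ↦ ∫ N(y; ŷ, W) dp(W)`, when `W` has distribution `p`. -/
noncomputable def predictiveDensity {ι : Type*} [Fintype ι] [DecidableEq ι]
    (p : Measure (Matrix ι ι ℝ)) (yhat : ι → ℝ) (y : ι → ℝ) : ℝ≥0∞ :=
  ∫⁻ W, ENNReal.ofReal (gaussianDensity yhat W y) ∂p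

/-- The base forecast distribution: the posterior predictive distribution of the series at the
forecast time, given the residuals `R`, for the point forecast `ŷ`. -/
noncomputable def baseForecast {ι : Type*} [Fintype ι] [DecidableEq ι] {T : ℕ}
    (prior : Measure (Matrix ι ι ℝ)) (R : Matrix ι (Fin T) ℝ) (yhat : ι → ℝ) :
    Measure (ι → ℝ) :=
  volume.withDensity (predictiveDensity (bayesPosterior prior R) yhat)

/-- `ρ` is the conditional distribution of `X` given the (possibly null) event `Z = z` under `P`:
it is the value at `z` of a weakly continuous version of the regular conditional distribution of
`X` given `Z`, and `z` lies in the support of the law of `Z`. On separable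
metric spaces with their Borel sets there is at most one such `ρ`, since two weakly continuous versions agree almost everywhere, hence on the support of the law of `Z`. -/
def IsCondLawAt {Ω E F : Type*} [MeasurableSpace Ω]
    [TopologicalSpace E] [MeasurableSpace E] [TopologicalSpace F] [MeasurableSpace F]
    (P : Measure Ω) (X : Ω → E) (Z : Ω → F) (z : F) (ρ : Measure E) : Prop :=
  z ∈ (P.map Z).support ∧
  ∃ κ : Kernel F E, IsMarkovKernel κ ∧
    (∀ f : BoundedContinuousFunction E ℝ, Continuous fun w => ∫ x, f x ∂(κ w)) ∧
    P.map (fun ω => (Z ω, X ω)) = (P.map Z) ⊗ₘ κ ∧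
    κ z = ρ

/-- The distribution on the bottom series obtained by slicing a joint density `g` of upper and
bottom series over the coherent subspace `{(u, b) : u = A b}` and renormalizing it. -/
noncomputable def sliceLaw {nu nb : ℕ} (A : Matrix (Fin nu) (Fin nb) ℝ)
    (g : (Fin nu ⊕ Fin nb → ℝ) → ℝ≥0∞) : Measure (Fin nb → ℝ) :=
  (∫⁻ b, g (Sum.elim (A *ᵥ b) b))⁻¹ • volume.withDensity fun b => g (Sum.elim (A *ᵥ b) b)

end HierRec

open HierRec

set_option linter.unusedSectionVars false

namespace HierRec

/-! ### Block matrices parametrized by their Schur complement -/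

section BlockMatrix
variable {m n : Type*} [Fintype m] [Fintype n] [DecidableEq m] [DecidableEq n]

/-! Conjugacy reduces everything to one integral. The Inverse-Wishart kernel times a Gaussian
likelihood is again an Inverse-Wishart kernel, with `R * Rᵀ` added to the scale and `T` to the
degrees of freedom (`invWishartKernel_mul_likelihood`). The predictive density at `y` treats `z = y
- ŷ` as one more residual, so it is a ratio of total masses of two such kernels. That mass is a
constant times `Ψ.det ^ (-ν / 2)` (`exists_lintegral_invWishartKernel_eq`), and the matrix
determinant lemma makes the ratio proportional to `(1 + zᵀ Ψ'⁻¹ z) ^ (-(ν' + 1) / 2)`. The value of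
the constant is never needed, only that it is positive, finite and independent of `Ψ`.

The mass is computed by induction on the size. Removing the last row and column of `W`, in Schur
coordinates, leaves a Gaussian integral over the column, an inverse-gamma integral over the Schur
complement, and the kernel of the smaller block with `ν - 1` degrees of freedom.

For the conditioning, the shear `(u, b) ↦ (u - A b, b)` turns `Ψ'` into a block matrix with corner
`Q`. Completing the square at incoherence `w` splits `1 + zᵀ Ψ'⁻¹ z` into `c w = 1 + (d + w)ᵀ Q⁻¹ (d
+ w)` plus a quadratic form in `b` centred at `μ w` (`dotProduct_inv_coherent`). Since `ν' + 1 = νt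
+ nb`, each slice is a positive factor `η w` times a t-density with location `μ w` and scale `(c w /
νt) • S`. These t-laws are affine images of a single one, hence weakly continuous in `w`; the value
at `w = 0` is the claim, and the same factorization at `w = 0` gives the renormalized slice. -/

theorem posDef_fromBlocks_diagonal_iff {D : Matrix m m ℝ} {S : Matrix n n ℝ} :
    (fromBlocks D 0 0 S).PosDef ↔ D.PosDef ∧ S.PosDef := by
  constructor
  · intro h
    exact ⟨h.submatrix (e := Sum.inl) Sum.inl_injective,
      h.submatrix (e := Sum.inr) Sum.inr_injective⟩
  · rintro ⟨hD, hS⟩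
    refine PosDef.of_dotProduct_mulVec_pos ?_ ?_
    · exact IsHermitian.fromBlocks hD.1 (by simp) hS.1
    · intro x hx
      have e : star x ⬝ᵥ (fromBlocks D 0 0 S *ᵥ x) =
          star (x ∘ Sum.inl) ⬝ᵥ (D *ᵥ (x ∘ Sum.inl)) +
          star (x ∘ Sum.inr) ⬝ᵥ (S *ᵥ (x ∘ Sum.inr)) := by
        rw [fromBlocks_mulVec]
        simp [dotProduct, Fintype.sum_sum_type]
      rw [e]
      by_cases h1 : x ∘ Sum.inl = 0
      · have h2 : x ∘ Sum.inr ≠ 0 := by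
          intro h2
          apply hx
          funext i
          rcases i with i | i
          · exact congrFun h1 i
          · exact congrFun h2 i
        rw [h1]
        simpa using hS.dotProduct_mulVec_pos h2
      · exact add_pos_of_pos_of_nonneg (hD.dotProduct_mulVec_pos h1)
          (hS.posSemidef.dotProduct_mulVec_nonneg _)

theorem isSymm_of_posDef {D : Matrix m m ℝ} (hD : D.PosDef) : Dᵀ = D := by
  simpa [conjTranspose_eq_transpose_of_trivial] using hD.1.eq

theorem inv_transpose_of_posDef {D : Matrix m m ℝ} (hD : D.PosDef) : (D⁻¹)ᵀ = D⁻¹ :=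
  isSymm_of_posDef hD.inv

theorem isUnit_det_of_posDef {D : Matrix m m ℝ} (hD : D.PosDef) : IsUnit D.det :=
  hD.det_pos.ne'.isUnit

/-- Block LDLᵀ factorization. Using the Schur complement `S` as a free coordinate, in place of the
lower right block, makes positivity and determinant split into a condition or factor for `D` and one
for `S`. -/
theorem fromBlocks_schur_eq {D : Matrix m m ℝ} (hD : D.PosDef) (B : Matrix m n ℝ)
    (S : Matrix n n ℝ) :
    fromBlocks D B Bᵀ (S + Bᵀ * D⁻¹ * B) =
      fromBlocks 1 0 (Bᵀ * D⁻¹) 1 * fromBlocks D 0 0 S * star (fromBlocks 1 0 (Bᵀ * D⁻¹) 1) := by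
  have hu := isUnit_det_of_posDef hD
  simp [star_eq_conjTranspose, conjTranspose_eq_transpose_of_trivial, fromBlocks_transpose,
    fromBlocks_multiply, inv_transpose_of_posDef hD, Matrix.mul_assoc, add_comm,
    nonsing_inv_mul _ hu,
    mul_nonsing_inv_cancel_left _ _ hu]

theorem posDef_fromBlocks_schur_iff {D : Matrix m m ℝ} (hD : D.PosDef) (B : Matrix m n ℝ)
    (S : Matrix n n ℝ) :
    (fromBlocks D B Bᵀ (S + Bᵀ * D⁻¹ * B)).PosDef ↔ S.PosDef := by
  have hU : IsUnit (fromBlocks (1 : Matrix m m ℝ) 0 (Bᵀ * D⁻¹) (1 : Matrix n n ℝ)) := by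
    rw [isUnit_iff_isUnit_det]
    simp
  rw [fromBlocks_schur_eq hD, IsUnit.posDef_star_right_conjugate_iff hU,
    posDef_fromBlocks_diagonal_iff]
  exact and_iff_right hD

theorem det_fromBlocks_schur {D : Matrix m m ℝ} (hD : D.PosDef) (B : Matrix m n ℝ)
    (S : Matrix n n ℝ) :
    (fromBlocks D B Bᵀ (S + Bᵀ * D⁻¹ * B)).det = D.det * S.det := by
  rw [fromBlocks_schur_eq hD, det_mul, det_mul]
  simp [star_eq_conjTranspose, conjTranspose_eq_transpose_of_trivial, fromBlocks_transpose,
    det_fromBlocks_zero₂₁]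

theorem inv_fromBlocks_schur {D : Matrix m m ℝ} (hD : D.PosDef) (B : Matrix m n ℝ)
    {S : Matrix n n ℝ} (hS : S.PosDef) :
    (fromBlocks D B Bᵀ (S + Bᵀ * D⁻¹ * B))⁻¹ =
      fromBlocks (D⁻¹ + D⁻¹ * B * S⁻¹ * (Bᵀ * D⁻¹)) (-(D⁻¹ * B * S⁻¹))
        (-(S⁻¹ * (Bᵀ * D⁻¹))) S⁻¹ := by
  have hu := isUnit_det_of_posDef hD
  have hv := isUnit_det_of_posDef hS
  apply inv_eq_right_inv
  rw [fromBlocks_multiply, ← fromBlocks_one]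
  congr 1
  · simp [Matrix.mul_add, Matrix.mul_assoc, mul_nonsing_inv _ hu,
      mul_nonsing_inv_cancel_left _ _ hu]
  · simp [Matrix.mul_assoc, mul_nonsing_inv_cancel_left _ _ hu]
  · simp [Matrix.mul_add, Matrix.add_mul, Matrix.mul_assoc,
      mul_nonsing_inv_cancel_left _ _ hv]
  · simp [Matrix.add_mul, Matrix.mul_assoc, mul_nonsing_inv _ hv]

/-- Completing the square in the quadratic form of the inverse of a block matrix. -/
theorem dotProduct_inv_fromBlocks_schur {D : Matrix m m ℝ} (hD : D.PosDef) (B : Matrix m n ℝ)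
    {S : Matrix n n ℝ} (hS : S.PosDef) (p : m → ℝ) (q : n → ℝ) :
    Sum.elim p q ⬝ᵥ ((fromBlocks D B Bᵀ (S + Bᵀ * D⁻¹ * B))⁻¹ *ᵥ Sum.elim p q) =
      p ⬝ᵥ (D⁻¹ *ᵥ p) +
        (q - (Bᵀ * D⁻¹) *ᵥ p) ⬝ᵥ (S⁻¹ *ᵥ (q - (Bᵀ * D⁻¹) *ᵥ p)) := by
  have h1 : ∀ z : n → ℝ, p ⬝ᵥ ((D⁻¹ * B) *ᵥ z) = ((Bᵀ * D⁻¹) *ᵥ p) ⬝ᵥ z := by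
    intro z
    rw [dotProduct_mulVec, ← mulVec_transpose, transpose_mul, inv_transpose_of_posDef hD]
  rw [inv_fromBlocks_schur hD B hS, fromBlocks_mulVec, sumElim_dotProduct_sumElim]
  simp only [Sum.elim_comp_inl, Sum.elim_comp_inr, Matrix.add_mulVec, Matrix.neg_mulVec,
    dotProduct_add, dotProduct_neg, sub_dotProduct, mulVec_sub, dotProduct_sub,
    ← Matrix.mulVec_mulVec _ (D⁻¹ * B * S⁻¹), ← Matrix.mulVec_mulVec _ (D⁻¹ * B) S⁻¹,
    ← Matrix.mulVec_mulVec _ S⁻¹, h1]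
  ring

theorem trace_fromBlocks (P : Matrix m m ℝ) (Q : Matrix m n ℝ) (R : Matrix n m ℝ)
    (S : Matrix n n ℝ) : (fromBlocks P Q R S).trace = P.trace + S.trace := by
  simp [trace, Fintype.sum_sum_type]

/-- The second trace is quadratic in `D⁻¹ * B`; this is what makes the off-diagonal block Gaussian
once `D` and `S` are fixed. -/
theorem trace_mul_inv_fromBlocks_schur {D : Matrix m m ℝ} (hD : D.PosDef) (B : Matrix m n ℝ)
    {S : Matrix n n ℝ} (hS : S.PosDef) (P : Matrix m m ℝ) (q : Matrix m n ℝ) (r : Matrix n n ℝ) :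
    (fromBlocks P q qᵀ r * (fromBlocks D B Bᵀ (S + Bᵀ * D⁻¹ * B))⁻¹).trace =
      (P * D⁻¹).trace + ((r - qᵀ * (D⁻¹ * B) - (D⁻¹ * B)ᵀ * q
        + (D⁻¹ * B)ᵀ * P * (D⁻¹ * B)) * S⁻¹).trace := by
  have hX : Bᵀ * D⁻¹ = (D⁻¹ * B)ᵀ := by rw [transpose_mul, inv_transpose_of_posDef hD]
  rw [inv_fromBlocks_schur hD B hS, fromBlocks_multiply, trace_fromBlocks, hX]
  generalize D⁻¹ * B = X
  have e1 : (P * (X * S⁻¹ * Xᵀ)).trace = (Xᵀ * P * X * S⁻¹).trace := by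
    rw [← Matrix.mul_assoc, trace_mul_comm]; simp only [Matrix.mul_assoc]
  have e2 : (q * (S⁻¹ * Xᵀ)).trace = (Xᵀ * q * S⁻¹).trace := by
    rw [← Matrix.mul_assoc, trace_mul_comm]; simp only [Matrix.mul_assoc]
  simp only [Matrix.mul_add, Matrix.add_mul, Matrix.sub_mul, Matrix.mul_neg, trace_add, trace_sub,
    trace_neg, e1, e2, ← Matrix.mul_assoc qᵀ]
  ring

/-- Brings an arbitrary positive definite scale matrix into the Schur coordinates used by the
formulas above. -/
theorem exists_eq_fromBlocks_schur {W : Matrix (m ⊕ n) (m ⊕ n) ℝ} (hW : W.PosDef) :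
    ∃ (D : Matrix m m ℝ) (B : Matrix m n ℝ) (S : Matrix n n ℝ), D.PosDef ∧ S.PosDef ∧
      W = fromBlocks D B Bᵀ (S + Bᵀ * D⁻¹ * B) := by
  have hD : W.toBlocks₁₁.PosDef := hW.submatrix (e := Sum.inl) Sum.inl_injective
  have hT : W.toBlocks₂₁ = W.toBlocks₁₂ᵀ := by
    ext i j
    exact (congrFun (congrFun (isSymm_of_posDef hW) (Sum.inr i)) (Sum.inl j)).symm
  have hE : W = fromBlocks W.toBlocks₁₁ W.toBlocks₁₂ W.toBlocks₁₂ᵀ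
      ((W.toBlocks₂₂ - W.toBlocks₁₂ᵀ * W.toBlocks₁₁⁻¹ * W.toBlocks₁₂) +
        W.toBlocks₁₂ᵀ * W.toBlocks₁₁⁻¹ * W.toBlocks₁₂) := by
    rw [sub_add_cancel, ← hT, fromBlocks_toBlocks]
  refine ⟨_, _, _, hD, ?_, hE⟩
  rw [← posDef_fromBlocks_schur_iff hD W.toBlocks₁₂, ← hE]
  exact hW

end BlockMatrix

/-! ### Gamma, inverse-gamma and Gaussian integrals -/

section Integrals

theorem lintegral_rpow_mul_exp_neg_mul_Ioi {a r : ℝ} (ha : 0 < a) (hr : 0 < r) :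
    ∫⁻ t in Set.Ioi (0 : ℝ), ENNReal.ofReal (t ^ (a - 1) * Real.exp (-(r * t))) =
      ENNReal.ofReal ((1 / r) ^ a * Real.Gamma a) := by
  have h := Real.integral_rpow_mul_exp_neg_mul_Ioi ha hr
  have hpos : 0 < (1 / r) ^ a * Real.Gamma a := by
    have := Real.Gamma_pos_of_pos ha
    positivity
  rw [← h, ofReal_integral_eq_lintegral_ofReal]
  -- Integrability comes for free: otherwise the Bochner integral would take its default value 0,
  -- against the positive value just computed.
  · by_contra hni
    rw [integral_undef hni] at h
    exact hpos.ne h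
  · filter_upwards [ae_restrict_mem measurableSet_Ioi] with t ht
    have : (0 : ℝ) < t := ht
    positivity

/-- The substitution `s = t⁻¹` in the Gamma integral; this is the mass of the inverse-gamma law of a
scalar Schur complement. -/
theorem lintegral_rpow_mul_exp_neg_div_Ioi {a b : ℝ} (ha : 0 < a) (hb : 0 < b) :
    ∫⁻ s in Set.Ioi (0 : ℝ), ENNReal.ofReal (s ^ (-(a + 1)) * Real.exp (-(b / s))) =
      ENNReal.ofReal ((1 / b) ^ a * Real.Gamma a) := by
  rw [← lintegral_rpow_mul_exp_neg_mul_Ioi ha hb]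
  have himg : (fun x : ℝ => x⁻¹) '' Set.Ioi 0 = Set.Ioi (0 : ℝ) := by
    ext x
    constructor
    · rintro ⟨y, hy, rfl⟩
      exact Set.mem_Ioi.2 (inv_pos.2 (Set.mem_Ioi.1 hy))
    · intro hx
      exact ⟨x⁻¹, Set.mem_Ioi.2 (inv_pos.2 (Set.mem_Ioi.1 hx)), inv_inv x⟩
  have := lintegral_image_eq_lintegral_abs_deriv_mul (s := Set.Ioi (0 : ℝ))
    (f := fun x : ℝ => x⁻¹) (f' := fun x => -(x ^ 2)⁻¹) measurableSet_Ioi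
    (fun x hx => (hasDerivAt_inv (ne_of_gt hx)).hasDerivWithinAt) (inv_injective.injOn)
    (fun t => ENNReal.ofReal (t ^ (a - 1) * Real.exp (-(b * t))))
  rw [himg] at this
  rw [this]
  refine setLIntegral_congr_fun measurableSet_Ioi fun s hs => ?_
  have hs : 0 < s := hs
  rw [← ENNReal.ofReal_mul (abs_nonneg _), abs_neg, abs_of_pos (by positivity), ← mul_assoc,
    div_eq_mul_inv]
  congr 2
  rw [Real.inv_rpow hs.le, ← Real.rpow_neg hs.le, ← Real.rpow_natCast, ← Real.rpow_neg hs.le,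
    ← Real.rpow_add hs]
  congr 1
  push_cast
  ring

variable {ι : Type*} [Fintype ι] [DecidableEq ι]

theorem lintegral_comp_mulVec {M : Matrix ι ι ℝ} (hM : M.det ≠ 0) {f : (ι → ℝ) → ℝ≥0∞}
    (hf : Measurable f) :
    ∫⁻ x, f (M *ᵥ x) = ENNReal.ofReal |M.det⁻¹| * ∫⁻ x, f x := by
  have h := Real.map_matrix_volume_pi_eq_smul_volume_pi hM
  have hm : Measurable (toLin' M) := (LinearMap.continuous_on_pi _).measurable
  have := lintegral_map (μ := volume) hf hm
  rw [h, lintegral_smul_measure] at this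
  simpa using this.symm

theorem lintegral_exp_neg_mul_dotProduct_self {t : ℝ} (ht : 0 < t) :
    ∫⁻ x : ι → ℝ, ENNReal.ofReal (Real.exp (-(t * (x ⬝ᵥ x)))) =
      ENNReal.ofReal ((Real.pi / t) ^ ((Fintype.card ι : ℝ) / 2)) := by
  have e : ∀ x : ι → ℝ, Real.exp (-(t * (x ⬝ᵥ x))) = ∏ i, Real.exp (-t * x i ^ 2) := by
    intro x
    rw [← Real.exp_sum, dotProduct, Finset.mul_sum, ← Finset.sum_neg_distrib]
    congr 1
    refine Finset.sum_congr rfl fun i _ => ?_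
    ring
  simp_rw [e]
  rw [← ofReal_integral_eq_lintegral_ofReal]
  · rw [integral_fintype_prod_volume_eq_pow (fun y : ℝ => Real.exp (-t * y ^ 2)),
      integral_gaussian, Real.sqrt_eq_rpow, ← Real.rpow_natCast, ← Real.rpow_mul (by positivity)]
    congr 2
    ring
  · exact Integrable.fintype_prod (f := fun _ y => Real.exp (-t * y ^ 2))
      (fun _ => integrable_exp_neg_mul_sq ht)
  · exact Filter.Eventually.of_forall fun x => by positivity

open scoped MatrixOrder in
theorem exists_transpose_mul_self_eq {P : Matrix ι ι ℝ} (hP : P.PosDef) :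
    ∃ M : Matrix ι ι ℝ, M.det ≠ 0 ∧ P = Mᵀ * M := by
  obtain ⟨M, hM⟩ := CStarAlgebra.nonneg_iff_eq_star_mul_self.mp hP.posSemidef.nonneg
  rw [star_eq_conjTranspose, conjTranspose_eq_transpose_of_trivial] at hM
  refine ⟨M, ?_, hM⟩
  intro h
  have := hP.det_pos
  rw [hM, det_mul, h] at this
  simp at this

/-- The Gaussian integral for a positive definite quadratic form. -/
theorem lintegral_exp_neg_mul_quadratic {P : Matrix ι ι ℝ} (hP : P.PosDef) {t : ℝ} (ht : 0 < t)
    (c : ι → ℝ) :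
    ∫⁻ x : ι → ℝ, ENNReal.ofReal (Real.exp (-(t * ((x - c) ⬝ᵥ (P *ᵥ (x - c)))))) =
      ENNReal.ofReal ((Real.pi / t) ^ ((Fintype.card ι : ℝ) / 2) * P.det ^ (-(1 : ℝ) / 2)) := by
  rw [lintegral_sub_right_eq_self
    (fun x : ι → ℝ => ENNReal.ofReal (Real.exp (-(t * (x ⬝ᵥ (P *ᵥ x))))))]
  obtain ⟨M, hM, rfl⟩ := exists_transpose_mul_self_eq hP
  have e : ∀ x : ι → ℝ, x ⬝ᵥ ((Mᵀ * M) *ᵥ x) = (M *ᵥ x) ⬝ᵥ (M *ᵥ x) := by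
    intro x
    rw [← mulVec_mulVec, dotProduct_mulVec, vecMul_transpose]
  simp_rw [e]
  rw [lintegral_comp_mulVec (f := fun y => ENNReal.ofReal (Real.exp (-(t * (y ⬝ᵥ y))))) hM
    (by unfold dotProduct; fun_prop), lintegral_exp_neg_mul_dotProduct_self ht,
    ← ENNReal.ofReal_mul (abs_nonneg _), mul_comm]
  congr 2
  rw [det_mul, det_transpose, abs_inv, neg_div, Real.rpow_neg (mul_self_nonneg _),
    ← Real.sqrt_eq_rpow, Real.sqrt_mul_self_eq_abs]

end Integrals

/-! ### Measurability on matrices and the unnormalized Inverse-Wishart density -/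

section Measurability

instance instBorelSpaceMatrix {m n : Type*} [Countable m] [Countable n] :
    BorelSpace (Matrix m n ℝ) :=
  inferInstanceAs (BorelSpace (m → n → ℝ))

variable {ι : Type*} [Fintype ι] [DecidableEq ι]

theorem measurable_det : Measurable fun W : Matrix ι ι ℝ => W.det :=
  (continuous_id.matrix_det).measurable

theorem measurable_matrix_inv : Measurable fun W : Matrix ι ι ℝ => W⁻¹ := by
  simp_rw [inv_def, Ring.inverse_eq_inv']
  have h : Measurable fun W : Matrix ι ι ℝ => W.adjugate :=
    (continuous_id.matrix_adjugate).measurable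
  refine measurable_pi_iff.2 fun i => measurable_pi_iff.2 fun j => ?_
  exact measurable_det.inv.mul ((measurable_pi_apply j).comp ((measurable_pi_apply i).comp h))

/-- Positive definite means symmetric and positive semidefinite, which are closed conditions,
together with a nonzero determinant. -/
theorem measurableSet_posDef : MeasurableSet {W : Matrix ι ι ℝ | W.PosDef} := by
  have h : {W : Matrix ι ι ℝ | W.PosDef} =
      ({W | Wᵀ = W} ∩ ⋂ x : ι → ℝ, {W | 0 ≤ x ⬝ᵥ (W *ᵥ x)}) ∩ {W | W.det ≠ 0} := by
    ext W
    constructor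
    · intro hW
      refine ⟨⟨isSymm_of_posDef hW, ?_⟩, hW.det_pos.ne'⟩
      rw [Set.mem_iInter]
      intro x
      simpa using hW.posSemidef.dotProduct_mulVec_nonneg x
    · rintro ⟨⟨h1, h2⟩, h3⟩
      rw [Set.mem_iInter] at h2
      have hs : W.PosSemidef := PosSemidef.of_dotProduct_mulVec_nonneg
        (by rw [IsHermitian, conjTranspose_eq_transpose_of_trivial]; exact h1)
        (fun x => by simpa using h2 x)
      exact hs.posDef_iff_det_ne_zero.2 h3
  rw [h]
  refine MeasurableSet.inter (MeasurableSet.inter ?_ ?_) ?_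
  · exact (isClosed_eq (continuous_id.matrix_transpose) continuous_id).measurableSet
  · refine IsClosed.measurableSet (isClosed_iInter fun x => ?_)
    exact isClosed_le continuous_const
      (Continuous.dotProduct continuous_const (continuous_id.matrix_mulVec continuous_const))
  · exact measurable_det (measurableSet_singleton 0).compl

theorem measurable_symMatrix : Measurable (symMatrix (ι := ι)) :=
  measurable_pi_iff.2 fun i => measurable_pi_iff.2 fun j => measurable_pi_apply s(i, j)

theorem measurable_trace_mul_inv (Ψ : Matrix ι ι ℝ) :
    Measurable fun W : Matrix ι ι ℝ => (Ψ * W⁻¹).trace := by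
  have : Continuous fun W : Matrix ι ι ℝ => (Ψ * W).trace :=
    (continuous_const.matrix_mul continuous_id).matrix_trace
  exact this.measurable.comp measurable_matrix_inv

open Classical in
/-- The Inverse-Wishart density without its normalizing constant. -/
noncomputable def invWishartKernel (Ψ : Matrix ι ι ℝ) (ν : ℝ) (W : Matrix ι ι ℝ) : ℝ :=
  if W.PosDef then
    W.det ^ (-(ν + Fintype.card ι + 1) / 2) * Real.exp (-(Ψ * W⁻¹).trace / 2)
  else 0

theorem invWishartKernel_of_posDef (Ψ : Matrix ι ι ℝ) (ν : ℝ) {W : Matrix ι ι ℝ}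
    (hW : W.PosDef) : invWishartKernel Ψ ν W =
      W.det ^ (-(ν + Fintype.card ι + 1) / 2) * Real.exp (-(Ψ * W⁻¹).trace / 2) :=
  if_pos hW

theorem invWishartKernel_of_not_posDef (Ψ : Matrix ι ι ℝ) (ν : ℝ) {W : Matrix ι ι ℝ}
    (hW : ¬ W.PosDef) : invWishartKernel Ψ ν W = 0 :=
  if_neg hW

theorem invWishartKernel_nonneg (Ψ : Matrix ι ι ℝ) (ν : ℝ) (W : Matrix ι ι ℝ) :
    0 ≤ invWishartKernel Ψ ν W := by
  by_cases hW : W.PosDef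
  · rw [invWishartKernel_of_posDef _ _ hW]
    have := hW.det_pos
    positivity
  · rw [invWishartKernel_of_not_posDef _ _ hW]

theorem measurable_invWishartKernel (Ψ : Matrix ι ι ℝ) (ν : ℝ) :
    Measurable (invWishartKernel Ψ ν) := by
  classical
  unfold invWishartKernel
  refine Measurable.ite measurableSet_posDef ?_ measurable_const
  have h1 := measurable_det (ι := ι)
  have h2 := measurable_trace_mul_inv Ψ
  fun_prop

/-- Relabelling invariance, needed to pass between `Fin (n + 1)`, where the induction runs, and `Fin
n ⊕ Unit`, where the blocks live. -/
theorem invWishartKernel_submatrix {κ : Type*} [Fintype κ] [DecidableEq κ] (e : κ ≃ ι)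
    (Ψ : Matrix ι ι ℝ) (ν : ℝ) (W : Matrix ι ι ℝ) :
    invWishartKernel (Ψ.submatrix e e) ν (W.submatrix e e) = invWishartKernel Ψ ν W := by
  by_cases hW : W.PosDef
  · rw [invWishartKernel_of_posDef _ _ hW,
      invWishartKernel_of_posDef _ _ (hW.submatrix e.injective), det_submatrix_equiv_self,
      inv_submatrix_equiv, submatrix_mul_equiv, Fintype.card_congr e]
    congr 4
    exact e.sum_comp fun i => (Ψ * W⁻¹) i i
  · have hW' : ¬ (W.submatrix e e).PosDef := by
      intro h
      apply hW
      simpa using h.submatrix e.symm.injective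
    rw [invWishartKernel_of_not_posDef _ _ hW, invWishartKernel_of_not_posDef _ _ hW']

end Measurability

/-! ### Lebesgue measure on symmetric matrices: relabelling and block coordinates -/

section LebesgueSym

variable {ι κ : Type*} [Fintype ι] [DecidableEq ι] [Fintype κ] [DecidableEq κ]

theorem lintegral_lebesgueSym {f : Matrix ι ι ℝ → ℝ≥0∞} (hf : Measurable f) :
    ∫⁻ W, f W ∂lebesgueSym ι = ∫⁻ x : Sym2 ι → ℝ, f (symMatrix x) :=
  lintegral_map hf measurable_symMatrix

theorem lintegral_comp_equiv {α β : Type*} [Fintype α] [Fintype β] (e : α ≃ β)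
    (f : (β → ℝ) → ℝ≥0∞) :
    ∫⁻ x, f x = ∫⁻ y : α → ℝ, f (fun b => y (e.symm b)) :=
  ((volume_measurePreserving_piCongrLeft (fun _ : β => ℝ) e).lintegral_map_equiv f _).trans <| by
    refine lintegral_congr fun y => congrArg f ?_
    funext b
    obtain ⟨a, rfl⟩ := e.surjective b
    rw [Equiv.symm_apply_apply, MeasurableEquiv.coe_piCongrLeft, Equiv.piCongrLeft_apply_apply]

/-- The equivalence of unordered pairs induced by an equivalence. -/
def sym2Equiv {α β : Type*} (e : α ≃ β) : Sym2 α ≃ Sym2 β where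
  toFun := Sym2.map e
  invFun := Sym2.map e.symm
  left_inv z := by induction z using Sym2.ind; simp
  right_inv z := by induction z using Sym2.ind; simp

theorem lintegral_lebesgueSym_submatrix (e : ι ≃ κ) {f : Matrix κ κ ℝ → ℝ≥0∞}
    (hf : Measurable f) :
    ∫⁻ W, f W ∂lebesgueSym κ = ∫⁻ W, f (W.submatrix e.symm e.symm) ∂lebesgueSym ι := by
  rw [lintegral_lebesgueSym hf, lintegral_lebesgueSym, lintegral_comp_equiv (sym2Equiv e)]
  · rfl
  · exact hf.comp (continuous_id.matrix_submatrix e.symm e.symm).measurable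

/-- The unordered pairs in `ι ⊕ Unit`. -/
noncomputable def sym2SumUnitEquiv (ι : Type*) : Sym2 ι ⊕ (ι ⊕ Unit) ≃ Sym2 (ι ⊕ Unit) :=
  Equiv.ofBijective
    (Sum.elim (Sym2.map Sum.inl)
      (Sum.elim (fun i => s(Sum.inl i, Sum.inr ())) fun _ => s(Sum.inr (), Sum.inr ()))) <| by
    constructor
    · rintro (x | x | x) (y | y | y) h
      · exact congrArg _ (Sym2.map.injective Sum.inl_injective h)
      all_goals
        first
          | (induction x using Sym2.ind; simp_all)
          | (induction y using Sym2.ind; simp_all)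
          | simp_all
    · intro z
      induction z using Sym2.ind with
      | _ x y =>
      rcases x with x | x <;> rcases y with y | y
      · exact ⟨Sum.inl s(x, y), rfl⟩
      · exact ⟨Sum.inr (Sum.inl x), rfl⟩
      · exact ⟨Sum.inr (Sum.inl y), Sym2.eq_swap⟩
      · exact ⟨Sum.inr (Sum.inr ()), rfl⟩

theorem lintegral_sum_pi {α β : Type*} [Fintype α] [Fintype β] {f : (α ⊕ β → ℝ) → ℝ≥0∞}
    (hf : Measurable f) :
    ∫⁻ z, f z = ∫⁻ x : α → ℝ, ∫⁻ y : β → ℝ, f (Sum.elim x y) := by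
  have h := (volume_measurePreserving_sumPiEquivProdPi_symm (fun _ : α ⊕ β => ℝ))
  rw [h.lintegral_map_equiv f, Measure.volume_eq_prod, lintegral_prod]
  · refine lintegral_congr fun x => lintegral_congr fun y => ?_
    congr 1
  · exact (hf.comp h.measurable).aemeasurable

theorem lintegral_unit_pi (f : (Unit → ℝ) → ℝ≥0∞) :
    ∫⁻ z, f z = ∫⁻ a : ℝ, f (fun _ => a) :=
  ((volume_preserving_funUnique Unit ℝ).symm _).lintegral_map_equiv f _

/-- Lebesgue measure on the symmetric matrices of size `ι ⊕ Unit`, in terms of the blocks. -/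
theorem lintegral_lebesgueSym_sum_unit {f : Matrix (ι ⊕ Unit) (ι ⊕ Unit) ℝ → ℝ≥0∞}
    (hf : Measurable f) :
    ∫⁻ W, f W ∂lebesgueSym (ι ⊕ Unit) = ∫⁻ D, (∫⁻ v : ι → ℝ, ∫⁻ a : ℝ,
      f (fromBlocks D (replicateCol Unit v) (replicateCol Unit v)ᵀ (of fun _ _ => a)))
        ∂lebesgueSym ι := by
  have hfs := hf.comp (measurable_symMatrix (ι := ι ⊕ Unit))
  have hfe : Measurable fun y : Sym2 ι ⊕ (ι ⊕ Unit) → ℝ =>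
      f (symMatrix fun b => y ((sym2SumUnitEquiv ι).symm b)) := by
    refine hfs.comp (measurable_pi_iff.2 fun b => measurable_pi_apply _)
  have hblock : Measurable fun p : (Matrix ι ι ℝ × (ι → ℝ)) × ℝ =>
      fromBlocks p.1.1 (replicateCol Unit p.1.2) (replicateCol Unit p.1.2)ᵀ
        (of fun _ _ => p.2 : Matrix Unit Unit ℝ) := by
    refine measurable_pi_iff.2 fun i => measurable_pi_iff.2 fun j => ?_
    rcases i with i | i <;> rcases j with j | j
    · exact (measurable_pi_apply j).comp ((measurable_pi_apply i).comp
        (measurable_fst.comp measurable_fst))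
    · exact (measurable_pi_apply i).comp (measurable_snd.comp measurable_fst)
    · exact (measurable_pi_apply j).comp (measurable_snd.comp measurable_fst)
    · exact measurable_snd
  have hg : Measurable fun D : Matrix ι ι ℝ => ∫⁻ v : ι → ℝ, ∫⁻ a : ℝ,
      f (fromBlocks D (replicateCol Unit v) (replicateCol Unit v)ᵀ (of fun _ _ => a)) :=
    Measurable.lintegral_prod_right' (Measurable.lintegral_prod_right' (hf.comp hblock))
  rw [lintegral_lebesgueSym hf, lintegral_comp_equiv (sym2SumUnitEquiv ι), lintegral_sum_pi hfe,
    lintegral_lebesgueSym hg]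
  refine lintegral_congr fun x => ?_
  rw [lintegral_sum_pi]
  · refine lintegral_congr fun v => ?_
    rw [lintegral_unit_pi]
    refine lintegral_congr fun a => ?_
    congr 1
    -- The equivalence comes from bijectivity, so its inverse does not compute; evaluating it only
    -- at known images avoids unfolding it.
    have key : ∀ w : Sym2 ι ⊕ (ι ⊕ Unit), ∀ b, sym2SumUnitEquiv ι w = b →
        Sum.elim x (Sum.elim v fun _ => a) ((sym2SumUnitEquiv ι).symm b) =
          Sum.elim x (Sum.elim v fun _ => a) w := by
      rintro w b rfl
      rw [Equiv.symm_apply_apply]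
    ext i j
    rcases i with i | i <;> rcases j with j | j
    · exact key (Sum.inl s(i, j)) _ rfl
    · exact key (Sum.inr (Sum.inl i)) _ rfl
    · exact key (Sum.inr (Sum.inl j)) _ Sym2.eq_swap
    · exact key (Sum.inr (Sum.inr ())) _ rfl
  · refine hfe.comp (measurable_pi_iff.2 fun b => ?_)
    rcases b with b | b
    · exact measurable_const
    · exact measurable_pi_apply b

end LebesgueSym

/-! ### Total mass of the Inverse-Wishart kernel -/

section WishartIntegral

variable {ι : Type*} [Fintype ι] [DecidableEq ι]

theorem posDef_unit_iff {S : Matrix Unit Unit ℝ} : S.PosDef ↔ 0 < S () () := by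
  constructor
  · intro h
    exact h.diag_pos
  · intro h
    have : S = diagonal fun _ => S () () := by
      ext i j
      simp
    rw [this]
    exact PosDef.diagonal fun _ => h

theorem inv_unit_apply (S : Matrix Unit Unit ℝ) : S⁻¹ () () = (S () ())⁻¹ := by
  rw [inv_subsingleton]
  simp

theorem replicateCol_transpose_mul_replicateCol (v w : ι → ℝ) :
    (replicateCol Unit v)ᵀ * replicateCol Unit w = of fun _ _ => v ⬝ᵥ w := by
  ext
  rfl

theorem replicateCol_transpose_mul_mul_replicateCol (v w : ι → ℝ) (M : Matrix ι ι ℝ) :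
    (replicateCol Unit v)ᵀ * M * replicateCol Unit w = of fun _ _ => v ⬝ᵥ (M *ᵥ w) := by
  rw [Matrix.mul_assoc, ← replicateCol_mulVec, replicateCol_transpose_mul_replicateCol]

/-- The unnormalized Inverse-Wishart density in terms of the blocks and of the Schur complement. -/
theorem invWishartKernel_schur_unit {D : Matrix ι ι ℝ} (hD : D.PosDef) {P : Matrix ι ι ℝ}
    (hP : P.PosDef) (q : ι → ℝ) (σ ν s : ℝ) (v : ι → ℝ) :
    invWishartKernel (fromBlocks P (replicateCol Unit q) (replicateCol Unit q)ᵀ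
        ((of fun _ _ => σ) + (replicateCol Unit q)ᵀ * P⁻¹ * replicateCol Unit q)) ν
      (fromBlocks D (replicateCol Unit v) (replicateCol Unit v)ᵀ
        ((of fun _ _ => s) + (replicateCol Unit v)ᵀ * D⁻¹ * replicateCol Unit v)) =
    (Set.Ioi (0 : ℝ)).indicator (fun s =>
      D.det ^ (-(ν + Fintype.card ι + 2) / 2) * Real.exp (-(P * D⁻¹).trace / 2) *
      (s ^ (-(ν + Fintype.card ι + 2) / 2) * Real.exp (-(σ / 2 / s))) *
      Real.exp (-((2 * s)⁻¹ * ((D⁻¹ *ᵥ v - P⁻¹ *ᵥ q) ⬝ᵥ (P *ᵥ (D⁻¹ *ᵥ v - P⁻¹ *ᵥ q)))))) s := by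
  by_cases hs : 0 < s
  · have hS : (of fun _ _ => s : Matrix Unit Unit ℝ).PosDef := posDef_unit_iff.2 hs
    rw [Set.indicator_of_mem (Set.mem_Ioi.2 hs), invWishartKernel_of_posDef,
      det_fromBlocks_schur hD, trace_mul_inv_fromBlocks_schur hD _ hS]
    · have hu := isUnit_det_of_posDef hP
      have e1 : P *ᵥ (P⁻¹ *ᵥ q) = q := by rw [mulVec_mulVec, mul_nonsing_inv _ hu, one_mulVec]
      have e2 : (P⁻¹ *ᵥ q) ⬝ᵥ (P *ᵥ (D⁻¹ *ᵥ v)) = q ⬝ᵥ (D⁻¹ *ᵥ v) := by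
        rw [dotProduct_mulVec, ← mulVec_transpose, isSymm_of_posDef hP, e1]
      have e3 : (P⁻¹ *ᵥ q) ⬝ᵥ q = q ⬝ᵥ (P⁻¹ *ᵥ q) := dotProduct_comm _ _
      have e4 : (D⁻¹ *ᵥ v) ⬝ᵥ q = q ⬝ᵥ (D⁻¹ *ᵥ v) := dotProduct_comm _ _
      rw [show D⁻¹ * replicateCol Unit v = replicateCol Unit (D⁻¹ *ᵥ v) from
          (replicateCol_mulVec _ _).symm, replicateCol_transpose_mul_mul_replicateCol,
        replicateCol_transpose_mul_mul_replicateCol, replicateCol_transpose_mul_replicateCol,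
        replicateCol_transpose_mul_replicateCol]
      simp only [mulVec_sub, sub_dotProduct, dotProduct_sub, e1, e2, e3, e4]
      rw [det_unique (of fun _ _ => s : Matrix Unit Unit ℝ), of_apply,
        Real.mul_rpow hD.det_pos.le hs.le, Fintype.card_sum, Fintype.card_unit, mul_assoc,
        mul_assoc, mul_assoc, mul_left_comm (Real.exp _), mul_assoc, ← Real.exp_add,
        ← Real.exp_add]
      push_cast
      congr 2
      · congr 1
        ring
      · congr 2
        ring
      · have hi : (of fun _ _ => s : Matrix Unit Unit ℝ)⁻¹ = of fun _ _ => s⁻¹ := by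
          ext
          exact inv_unit_apply _
        rw [hi]
        generalize (P * D⁻¹).trace = t
        simp only [trace, diag, Finset.univ_unique, Finset.sum_singleton, mul_apply,
          Matrix.add_apply, Matrix.sub_apply, of_apply]
        congr 1
        field_simp
        ring
    · exact (posDef_fromBlocks_schur_iff hD _ _).2 hS
  · rw [Set.indicator_of_notMem (by simpa using hs), invWishartKernel_of_not_posDef]
    rw [posDef_fromBlocks_schur_iff hD, posDef_unit_iff]
    exact hs

/-- With `D` fixed, translate `a` to the Schur complement `s` and put `x = D⁻¹ *ᵥ v`. Given `s`, the
variable `x` has a Gaussian weight with mean `P⁻¹ *ᵥ q` and covariance `s • P⁻¹`; what remains in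
`s` is an inverse-gamma weight of shape `ν / 2`. -/
theorem lintegral_invWishartKernel_schur_unit {D : Matrix ι ι ℝ} (hD : D.PosDef)
    {P : Matrix ι ι ℝ} (hP : P.PosDef) (q : ι → ℝ) {σ ν : ℝ} (hσ : 0 < σ) (hν : 0 < ν) :
    ∫⁻ v : ι → ℝ, ∫⁻ a : ℝ, ENNReal.ofReal
      (invWishartKernel (fromBlocks P (replicateCol Unit q) (replicateCol Unit q)ᵀ
        ((of fun _ _ => σ) + (replicateCol Unit q)ᵀ * P⁻¹ * replicateCol Unit q)) ν
        (fromBlocks D (replicateCol Unit v) (replicateCol Unit v)ᵀ (of fun _ _ => a))) =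
    ENNReal.ofReal ((2 * Real.pi) ^ ((Fintype.card ι : ℝ) / 2) * P.det ^ (-(1 : ℝ) / 2) *
      ((2 / σ) ^ (ν / 2) * Real.Gamma (ν / 2))) *
      ENNReal.ofReal (invWishartKernel P (ν - 1) D) := by
  set K : ℝ := D.det ^ (-(ν + Fintype.card ι + 2) / 2) * Real.exp (-(P * D⁻¹).trace / 2) with hK
  have hdetD := hD.det_pos
  have hdetP := hP.det_pos
  have hK0 : 0 ≤ K := by positivity
  set g : ℝ → ℝ := fun s => s ^ (-(ν + Fintype.card ι + 2) / 2) * Real.exp (-(σ / 2 / s)) with hg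
  set E : ℝ → (ι → ℝ) → ℝ := fun s x =>
    Real.exp (-((2 * s)⁻¹ * ((x - P⁻¹ *ᵥ q) ⬝ᵥ (P *ᵥ (x - P⁻¹ *ᵥ q))))) with hE
  have hquad : Continuous fun x : ι → ℝ => (x - P⁻¹ *ᵥ q) ⬝ᵥ (P *ᵥ (x - P⁻¹ *ᵥ q)) := by
    fun_prop
  have hEm : Measurable fun p : ℝ × (ι → ℝ) => E p.1 p.2 := by
    have := hquad.measurable
    simp only [hE]
    fun_prop
  have hgm : Measurable g := by fun_prop
  have h1 : ∀ v : ι → ℝ, (∫⁻ a : ℝ, ENNReal.ofReal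
      (invWishartKernel (fromBlocks P (replicateCol Unit q) (replicateCol Unit q)ᵀ
        ((of fun _ _ => σ) + (replicateCol Unit q)ᵀ * P⁻¹ * replicateCol Unit q)) ν
        (fromBlocks D (replicateCol Unit v) (replicateCol Unit v)ᵀ (of fun _ _ => a)))) =
      ∫⁻ s in Set.Ioi (0 : ℝ), ENNReal.ofReal (K * g s) * ENNReal.ofReal (E s (D⁻¹ *ᵥ v)) := by
    intro v
    -- For fixed `v` the corner entry differs from the Schur complement by a constant, so the change
    -- of variable is a translation.
    rw [← lintegral_add_right_eq_self _ (v ⬝ᵥ (D⁻¹ *ᵥ v)), ← lintegral_indicator measurableSet_Ioi]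
    refine lintegral_congr fun s => ?_
    have : (of fun _ _ => s + v ⬝ᵥ (D⁻¹ *ᵥ v) : Matrix Unit Unit ℝ) =
        (of fun _ _ => s) + (replicateCol Unit v)ᵀ * D⁻¹ * replicateCol Unit v := by
      rw [replicateCol_transpose_mul_mul_replicateCol]
      rfl
    rw [this, invWishartKernel_schur_unit hD hP]
    by_cases hs : 0 < s
    · have hgs : 0 ≤ g s := by positivity
      rw [Set.indicator_of_mem (Set.mem_Ioi.2 hs), Set.indicator_of_mem (Set.mem_Ioi.2 hs),
        ← ENNReal.ofReal_mul (mul_nonneg hK0 hgs)]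
    · rw [Set.indicator_of_notMem (by simpa using hs), Set.indicator_of_notMem (by simpa using hs),
        ENNReal.ofReal_zero]
  simp_rw [h1]
  rw [lintegral_lintegral_swap]
  swap
  · refine Measurable.aemeasurable ?_
    refine ((hgm.const_mul K).comp measurable_snd).ennreal_ofReal.mul ?_
    refine (hEm.comp (measurable_snd.prodMk ?_)).ennreal_ofReal
    exact (show Continuous fun v : ι → ℝ => D⁻¹ *ᵥ v by fun_prop).measurable.comp measurable_fst
  have h2 : ∀ s ∈ Set.Ioi (0 : ℝ),
      ∫⁻ v : ι → ℝ, ENNReal.ofReal (K * g s) * ENNReal.ofReal (E s (D⁻¹ *ᵥ v)) =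
      ENNReal.ofReal (K * D.det * (2 * Real.pi) ^ ((Fintype.card ι : ℝ) / 2) *
        P.det ^ (-(1 : ℝ) / 2)) *
        ENNReal.ofReal (s ^ (-(ν / 2 + 1)) * Real.exp (-(σ / 2 / s))) := by
    intro s hs
    have hs : 0 < s := hs
    have hgs : 0 ≤ g s := by positivity
    have hEs : Measurable fun x => ENNReal.ofReal (E s x) :=
      (hEm.comp (measurable_const.prodMk measurable_id)).ennreal_ofReal
    have hEc : Measurable fun v => ENNReal.ofReal (E s (D⁻¹ *ᵥ v)) :=
      hEs.comp (show Continuous fun v : ι → ℝ => D⁻¹ *ᵥ v by fun_prop).measurable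
    rw [lintegral_const_mul _ hEc,
      lintegral_comp_mulVec (f := fun x => ENNReal.ofReal (E s x)) hD.inv.det_pos.ne' hEs,
      lintegral_exp_neg_mul_quadratic hP (by positivity),
      ← ENNReal.ofReal_mul (abs_nonneg _), ← ENNReal.ofReal_mul (by positivity),
      ← ENNReal.ofReal_mul (by positivity)]
    congr 1
    rw [det_nonsing_inv, Ring.inverse_eq_inv', inv_inv, abs_of_pos hdetD, div_inv_eq_mul,
      show Real.pi * (2 * s) = 2 * Real.pi * s by ring, Real.mul_rpow (by positivity) hs.le, hg,
      -- The Gaussian integral contributes `s ^ (p / 2)`, with `p` the size of `D`, which removes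
      -- the dimension from the exponent of `s`.
      show -(ν / 2 + 1) = -(ν + Fintype.card ι + 2) / 2 + (Fintype.card ι : ℝ) / 2 by ring,
      Real.rpow_add hs]
    ring
  rw [setLIntegral_congr_fun measurableSet_Ioi h2, lintegral_const_mul _ (by fun_prop),
    lintegral_rpow_mul_exp_neg_div_Ioi (half_pos hν) (half_pos hσ), invWishartKernel_of_posDef _ _ hD,
    ← ENNReal.ofReal_mul (by positivity), ← ENNReal.ofReal_mul]
  · congr 1
    -- The Jacobian `D.det` of `v = D x` raises the exponent of `D.det` by one, to that of the
    -- kernel with `ν - 1`.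
    rw [hK, show -(ν - 1 + Fintype.card ι + 1) / 2 = -(ν + Fintype.card ι + 2) / 2 + 1 by ring,
      Real.rpow_add hdetD, Real.rpow_one, one_div_div]
    ring
  · have := Real.Gamma_pos_of_pos (half_pos hν)
    positivity

theorem lintegral_invWishartKernel_sum_unit {ν c : ℝ} (hν : 0 < ν)
    (ih : ∀ Ψ : Matrix ι ι ℝ, Ψ.PosDef →
      ∫⁻ W, ENNReal.ofReal (invWishartKernel Ψ (ν - 1) W) ∂lebesgueSym ι =
        ENNReal.ofReal (c * Ψ.det ^ (-(ν - 1) / 2)))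
    {Ψ : Matrix (ι ⊕ Unit) (ι ⊕ Unit) ℝ} (hΨ : Ψ.PosDef) :
    ∫⁻ W, ENNReal.ofReal (invWishartKernel Ψ ν W) ∂lebesgueSym (ι ⊕ Unit) =
      ENNReal.ofReal ((2 * Real.pi) ^ ((Fintype.card ι : ℝ) / 2) * 2 ^ (ν / 2) *
        Real.Gamma (ν / 2) * c * Ψ.det ^ (-ν / 2)) := by
  obtain ⟨P, B, S, hP, hS, rfl⟩ := exists_eq_fromBlocks_schur hΨ
  obtain ⟨q, rfl⟩ : ∃ q : ι → ℝ, B = replicateCol Unit q := ⟨fun i => B i (), by ext; rfl⟩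
  rw [det_fromBlocks_schur hP, det_unique S]
  have hσ := posDef_unit_iff.1 hS
  obtain ⟨σ, rfl⟩ : ∃ σ : ℝ, S = of fun _ _ => σ := ⟨S () (), by ext; rfl⟩
  change 0 < σ at hσ
  rw [lintegral_lebesgueSym_sum_unit (measurable_invWishartKernel _ _).ennreal_ofReal]
  have e : ∀ D : Matrix ι ι ℝ, (∫⁻ v : ι → ℝ, ∫⁻ a : ℝ, ENNReal.ofReal
      (invWishartKernel (fromBlocks P (replicateCol Unit q) (replicateCol Unit q)ᵀ
        ((of fun _ _ => σ) + (replicateCol Unit q)ᵀ * P⁻¹ * replicateCol Unit q)) ν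
        (fromBlocks D (replicateCol Unit v) (replicateCol Unit v)ᵀ (of fun _ _ => a)))) =
    ENNReal.ofReal ((2 * Real.pi) ^ ((Fintype.card ι : ℝ) / 2) * P.det ^ (-(1 : ℝ) / 2) *
      ((2 / σ) ^ (ν / 2) * Real.Gamma (ν / 2))) *
      ENNReal.ofReal (invWishartKernel P (ν - 1) D) := by
    intro D
    by_cases hD : D.PosDef
    · exact lintegral_invWishartKernel_schur_unit hD hP q hσ hν
    · have : ∀ (v : ι → ℝ) (a : ℝ), ¬ (fromBlocks D (replicateCol Unit v) (replicateCol Unit v)ᵀ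
          (of fun _ _ => a : Matrix Unit Unit ℝ)).PosDef := fun v a h =>
        hD (h.submatrix (e := Sum.inl) Sum.inl_injective)
      rw [invWishartKernel_of_not_posDef _ _ hD, ENNReal.ofReal_zero, mul_zero]
      refine (lintegral_congr fun v => (lintegral_congr fun a => ?_).trans lintegral_zero).trans
        lintegral_zero
      rw [invWishartKernel_of_not_posDef _ _ (this v a), ENNReal.ofReal_zero]
  simp_rw [e]
  rw [lintegral_const_mul _ (measurable_invWishartKernel _ _).ennreal_ofReal, ih P hP,
    ← ENNReal.ofReal_mul]
  · congr 1
    have hdet := hP.det_pos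
    change _ = _ * (P.det * σ) ^ (-ν / 2)
    rw [Real.mul_rpow hdet.le hσ.le, Real.div_rpow (by norm_num) hσ.le, neg_div 2 ν,
      Real.rpow_neg hσ.le, show -(ν / 2) = -1 / 2 + -(ν - 1) / 2 by ring, Real.rpow_add hdet]
    ring
  · have := Real.Gamma_pos_of_pos (half_pos hν)
    have := hP.det_pos
    positivity

/-- The normalizing constant of the Inverse-Wishart distribution, as a function of the scale
matrix. -/
theorem exists_lintegral_invWishartKernel_eq_of_fin (n : ℕ) :
    ∀ ν : ℝ, (n : ℝ) - 1 < ν → ∃ c : ℝ, 0 < c ∧ ∀ Ψ : Matrix (Fin n) (Fin n) ℝ, Ψ.PosDef →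
      ∫⁻ W, ENNReal.ofReal (invWishartKernel Ψ ν W) ∂lebesgueSym (Fin n) =
        ENNReal.ofReal (c * Ψ.det ^ (-ν / 2)) := by
  induction n with
  | zero =>
    intro ν hν
    -- In size zero there is one matrix, the kernel equals 1 there, and Lebesgue measure on a point
    -- has mass 1.
    refine ⟨1, one_pos, fun Ψ hΨ => ?_⟩
    rw [lintegral_lebesgueSym (measurable_invWishartKernel _ _).ennreal_ofReal]
    have h : ∀ W : Matrix (Fin 0) (Fin 0) ℝ, invWishartKernel Ψ ν W = 1 := by
      intro W
      rw [invWishartKernel_of_posDef]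
      · simp [trace]
      · rw [Subsingleton.elim W 1]
        exact PosDef.one
    simp_rw [h]
    simp [volume_pi]
  | succ n ih =>
    intro ν hν
    push_cast at hν
    obtain ⟨c, hc, h⟩ := ih (ν - 1) (by linarith)
    have hν0 : 0 < ν := by
      have : (0 : ℝ) ≤ n := n.cast_nonneg
      linarith
    refine ⟨(2 * Real.pi) ^ ((Fintype.card (Fin n) : ℝ) / 2) * 2 ^ (ν / 2) *
        Real.Gamma (ν / 2) * c, ?_, fun Ψ hΨ => ?_⟩
    · have := Real.Gamma_pos_of_pos (half_pos hν0)
      positivity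
    let e : Fin n ⊕ Unit ≃ Fin (n + 1) := Fintype.equivOfCardEq (by simp)
    rw [lintegral_lebesgueSym_submatrix e (measurable_invWishartKernel _ _).ennreal_ofReal]
    have hk : ∀ W : Matrix (Fin n ⊕ Unit) (Fin n ⊕ Unit) ℝ,
        invWishartKernel Ψ ν (W.submatrix e.symm e.symm) =
          invWishartKernel (Ψ.submatrix e e) ν W := by
      intro W
      rw [← invWishartKernel_submatrix e]
      simp
    simp_rw [hk]
    rw [lintegral_invWishartKernel_sum_unit hν0 h (hΨ.submatrix e.injective),
      det_submatrix_equiv_self]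

theorem exists_lintegral_invWishartKernel_eq {ν : ℝ} (hν : (Fintype.card ι : ℝ) - 1 < ν) :
    ∃ c : ℝ, 0 < c ∧ ∀ Ψ : Matrix ι ι ℝ, Ψ.PosDef →
      ∫⁻ W, ENNReal.ofReal (invWishartKernel Ψ ν W) ∂lebesgueSym ι =
        ENNReal.ofReal (c * Ψ.det ^ (-ν / 2)) := by
  obtain ⟨c, hc, h⟩ := exists_lintegral_invWishartKernel_eq_of_fin _ ν hν
  refine ⟨c, hc, fun Ψ hΨ => ?_⟩
  let e := (Fintype.equivFin ι).symm
  rw [lintegral_lebesgueSym_submatrix e (measurable_invWishartKernel _ _).ennreal_ofReal]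
  have hk : ∀ W, invWishartKernel Ψ ν (W.submatrix e.symm e.symm) =
      invWishartKernel (Ψ.submatrix e e) ν W := by
    intro W
    rw [← invWishartKernel_submatrix e]
    simp
  simp_rw [hk]
  rw [h _ (hΨ.submatrix e.injective), det_submatrix_equiv_self]

end WishartIntegral

/-! ### Conjugacy, the posterior, and the predictive density -/

section Posterior

variable {ι : Type*} [Fintype ι] [DecidableEq ι] {T : ℕ}

theorem multivariateGamma_pos {p : ℕ} {a : ℝ} (h : (p : ℝ) - 1 < 2 * a) :
    0 < multivariateGamma p a := by
  refine mul_pos (by positivity) (Finset.prod_pos fun k hk => Real.Gamma_pos_of_pos ?_)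
  have : (k : ℝ) + 1 ≤ p := by exact_mod_cast Finset.mem_range.1 hk
  linarith

/-- All that is needed of the prior's normalizing constant is its positivity: its value cancels in
Bayes' rule. -/
theorem exists_invWishartDensity_eq {Ψ : Matrix ι ι ℝ} {ν : ℝ} (hΨ : Ψ.PosDef)
    (hν : (Fintype.card ι : ℝ) - 1 < ν) :
    ∃ c : ℝ, 0 < c ∧ ∀ W, invWishartDensity Ψ ν W = c * invWishartKernel Ψ ν W := by
  refine ⟨Ψ.det ^ (ν / 2) /
    (2 ^ (ν * Fintype.card ι / 2) * multivariateGamma (Fintype.card ι) (ν / 2)), ?_, fun W => ?_⟩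
  · have := multivariateGamma_pos (p := Fintype.card ι) (a := ν / 2) (by linarith)
    have := hΨ.det_pos
    positivity
  · unfold invWishartDensity invWishartKernel
    split_ifs
    · ring
    · simp

theorem trace_mul_transpose_mul (R : Matrix ι (Fin T) ℝ) (V : Matrix ι ι ℝ) :
    (R * Rᵀ * V).trace = ∑ j, (fun i => R i j) ⬝ᵥ (V *ᵥ fun i => R i j) := by
  rw [Matrix.mul_assoc, trace_mul_comm, Matrix.mul_assoc]
  simp [trace, mul_apply, dotProduct, mulVec]

/-- The inverse Wishart family is conjugate to the Gaussian likelihood. -/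
theorem invWishartKernel_mul_likelihood (Ψ : Matrix ι ι ℝ) (ν : ℝ) (R : Matrix ι (Fin T) ℝ)
    (W : Matrix ι ι ℝ) :
    invWishartKernel Ψ ν W * likelihood R W =
      ((2 * Real.pi) ^ (-(Fintype.card ι : ℝ) / 2)) ^ T *
        invWishartKernel (Ψ + R * Rᵀ) (ν + T) W := by
  by_cases hW : W.PosDef
  · have hd := hW.det_pos
    rw [invWishartKernel_of_posDef _ _ hW, invWishartKernel_of_posDef _ _ hW, Matrix.add_mul,
      trace_add, trace_mul_transpose_mul]
    simp only [likelihood, gaussianDensity, sub_zero, Finset.prod_mul_distrib, Finset.prod_const,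
      Finset.card_univ, Fintype.card_fin]
    rw [← Real.exp_sum, ← Real.rpow_natCast (W.det ^ (-(1 : ℝ) / 2)), ← Real.rpow_mul hd.le,
      show -(ν + T + Fintype.card ι + 1) / 2 = -(ν + Fintype.card ι + 1) / 2 + -1 / 2 * T by ring,
      Real.rpow_add hd, ← Finset.sum_div, Finset.sum_neg_distrib]
    generalize ∑ j, (fun i => R i j) ⬝ᵥ (W⁻¹ *ᵥ fun i => R i j) = q
    rw [show -((Ψ * W⁻¹).trace + q) / 2 = -(Ψ * W⁻¹).trace / 2 + -q / 2 by ring, Real.exp_add]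
    ring
  · rw [invWishartKernel_of_not_posDef _ _ hW, invWishartKernel_of_not_posDef _ _ hW]
    simp

/-- Views a new observation as a residual matrix with one column, so that conjugacy applies a second
time. -/
theorem gaussianDensity_eq_likelihood (m : ι → ℝ) (W : Matrix ι ι ℝ) (y : ι → ℝ) :
    gaussianDensity m W y = likelihood (of fun i (_ : Fin 1) => (y - m) i) W := by
  simp only [likelihood, gaussianDensity, Finset.univ_unique, Finset.prod_singleton, of_apply,
    sub_zero]

theorem measurable_gaussianDensity (m : ι → ℝ) :
    Measurable fun p : (ι → ℝ) × Matrix ι ι ℝ => gaussianDensity m p.2 p.1 := by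
  have h1 : Measurable fun p : (ι → ℝ) × Matrix ι ι ℝ => p.2.det :=
    measurable_det.comp measurable_snd
  have h2 : ∀ i j, Measurable fun p : (ι → ℝ) × Matrix ι ι ℝ => p.2⁻¹ i j := fun i j =>
    (measurable_pi_apply j).comp ((measurable_pi_apply i).comp
      (measurable_matrix_inv.comp measurable_snd))
  have h3 : ∀ i, Measurable fun p : (ι → ℝ) × Matrix ι ι ℝ => p.1 i - m i := fun i =>
    ((measurable_pi_apply i).comp measurable_fst).sub_const _
  have h4 : Measurable fun p : (ι → ℝ) × Matrix ι ι ℝ => (p.1 - m) ⬝ᵥ (p.2⁻¹ *ᵥ (p.1 - m)) :=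
    Finset.measurable_sum _ fun i _ =>
      (h3 i).mul (Finset.measurable_sum _ fun j _ => (h2 i j).mul (h3 j))
  exact ((h1.pow_const _).const_mul _).mul (h4.neg.div_const _).exp

theorem measurable_gaussianDensity_right (m y : ι → ℝ) :
    Measurable fun W : Matrix ι ι ℝ => gaussianDensity m W y :=
  (measurable_gaussianDensity m).comp (measurable_const.prodMk measurable_id)

theorem measurable_likelihood (R : Matrix ι (Fin T) ℝ) : Measurable (likelihood R) :=
  Finset.measurable_prod _ fun _ _ => measurable_gaussianDensity_right _ _

theorem lintegral_gaussianDensity (m : ι → ℝ) {W : Matrix ι ι ℝ} (hW : W.PosDef) :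
    ∫⁻ y, ENNReal.ofReal (gaussianDensity m W y) = 1 := by
  have hd := hW.det_pos
  have h := lintegral_exp_neg_mul_quadratic hW.inv (t := 1 / 2) (by norm_num) m
  have e : ∀ y : ι → ℝ, ENNReal.ofReal (gaussianDensity m W y) =
      ENNReal.ofReal ((2 * Real.pi) ^ (-(Fintype.card ι : ℝ) / 2) * W.det ^ (-(1 : ℝ) / 2)) *
        ENNReal.ofReal (Real.exp (-(1 / 2 * ((y - m) ⬝ᵥ (W⁻¹ *ᵥ (y - m)))))) := by
    intro y
    rw [← ENNReal.ofReal_mul (by positivity), gaussianDensity]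
    congr 3
    ring
  simp_rw [e]
  rw [lintegral_const_mul' _ _ ENNReal.ofReal_ne_top, h, ← ENNReal.ofReal_mul (by positivity),
    ← ENNReal.ofReal_one, det_nonsing_inv, Ring.inverse_eq_inv', Real.inv_rpow hd.le]
  congr 1
  rw [neg_div, Real.rpow_neg (by positivity), show Real.pi / (1 / 2) = 2 * Real.pi by ring]
  have h1 : (2 * Real.pi) ^ ((Fintype.card ι : ℝ) / 2) ≠ 0 := by positivity
  have h2 : W.det ^ (-(1 : ℝ) / 2) ≠ 0 := by positivity
  field_simp

theorem posDef_add_mul_transpose {Ψ : Matrix ι ι ℝ} (hΨ : Ψ.PosDef) {n : Type*} [Fintype n]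
    (R : Matrix ι n ℝ) : (Ψ + R * Rᵀ).PosDef := by
  have := posSemidef_self_mul_conjTranspose R
  rw [conjTranspose_eq_transpose_of_trivial] at this
  exact hΨ.add_posSemidef this

theorem lintegral_invWishartKernel_ne_zero_and_ne_top {Ψ : Matrix ι ι ℝ} {ν : ℝ} (hΨ : Ψ.PosDef)
    (hν : (Fintype.card ι : ℝ) - 1 < ν) :
    ∫⁻ W, ENNReal.ofReal (invWishartKernel Ψ ν W) ∂lebesgueSym ι ≠ 0 ∧
    ∫⁻ W, ENNReal.ofReal (invWishartKernel Ψ ν W) ∂lebesgueSym ι ≠ ∞ := by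
  obtain ⟨c, hc, h⟩ := exists_lintegral_invWishartKernel_eq hν
  rw [h Ψ hΨ]
  refine ⟨?_, ENNReal.ofReal_ne_top⟩
  have := hΨ.det_pos
  rw [Ne, ENNReal.ofReal_eq_zero, not_le]
  positivity

theorem bayesPosterior_invWishart {Ψ : Matrix ι ι ℝ} {ν : ℝ} (hΨ : Ψ.PosDef)
    (hν : (Fintype.card ι : ℝ) - 1 < ν) (R : Matrix ι (Fin T) ℝ) :
    bayesPosterior (invWishart Ψ ν) R =
      (∫⁻ W, ENNReal.ofReal (invWishartKernel (Ψ + R * Rᵀ) (ν + T) W) ∂lebesgueSym ι)⁻¹ •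
        (lebesgueSym ι).withDensity
          fun W => ENNReal.ofReal (invWishartKernel (Ψ + R * Rᵀ) (ν + T) W) := by
  obtain ⟨c, hc, h⟩ := exists_invWishartDensity_eq hΨ hν
  set c' : ℝ := c * ((2 * Real.pi) ^ (-(Fintype.card ι : ℝ) / 2)) ^ T with hc'
  have hc'0 : 0 < c' := by positivity
  have hm : Measurable fun W => ENNReal.ofReal (invWishartDensity Ψ ν W) := by
    simp_rw [h]
    exact ((measurable_invWishartKernel Ψ ν).const_mul c).ennreal_ofReal
  have hL := (measurable_likelihood R).ennreal_ofReal
  have hk := (measurable_invWishartKernel (Ψ + R * Rᵀ) (ν + T)).ennreal_ofReal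
  have hprod : ∀ W, ENNReal.ofReal (invWishartDensity Ψ ν W) * ENNReal.ofReal (likelihood R W) =
      ENNReal.ofReal c' * ENNReal.ofReal (invWishartKernel (Ψ + R * Rᵀ) (ν + T) W) := by
    intro W
    rw [← ENNReal.ofReal_mul (by rw [h]; exact mul_nonneg hc.le (invWishartKernel_nonneg _ _ _)),
      ← ENNReal.ofReal_mul hc'0.le, h, mul_assoc, invWishartKernel_mul_likelihood, hc', mul_assoc]
  have h1 : (invWishart Ψ ν).withDensity (fun W => ENNReal.ofReal (likelihood R W)) =
      ENNReal.ofReal c' • (lebesgueSym ι).withDensity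
        fun W => ENNReal.ofReal (invWishartKernel (Ψ + R * Rᵀ) (ν + T) W) := by
    rw [invWishart, ← withDensity_mul _ hm hL, ← withDensity_smul _ hk]
    congr 1
    funext W
    exact hprod W
  have h2 : ∫⁻ W, ENNReal.ofReal (likelihood R W) ∂invWishart Ψ ν = ENNReal.ofReal c' *
      ∫⁻ W, ENNReal.ofReal (invWishartKernel (Ψ + R * Rᵀ) (ν + T) W) ∂lebesgueSym ι := by
    rw [invWishart, lintegral_withDensity_eq_lintegral_mul _ hm hL, ← lintegral_const_mul _ hk]
    exact lintegral_congr hprod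
  have hc0 : ENNReal.ofReal c' ≠ 0 := by simpa using hc'0
  rw [bayesPosterior, h1, h2, smul_smul, ENNReal.mul_inv (Or.inl hc0)
    (Or.inl ENNReal.ofReal_ne_top), mul_right_comm, ENNReal.inv_mul_cancel hc0
    ENNReal.ofReal_ne_top, one_mul]

/-- Integration against the posterior distribution. -/
theorem lintegral_bayesPosterior_invWishart {Ψ : Matrix ι ι ℝ} {ν : ℝ} (hΨ : Ψ.PosDef)
    (hν : (Fintype.card ι : ℝ) - 1 < ν) (R : Matrix ι (Fin T) ℝ) {f : Matrix ι ι ℝ → ℝ≥0∞}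
    (hf : Measurable f) :
    ∫⁻ W, f W ∂bayesPosterior (invWishart Ψ ν) R =
      (∫⁻ W, ENNReal.ofReal (invWishartKernel (Ψ + R * Rᵀ) (ν + T) W) ∂lebesgueSym ι)⁻¹ *
        ∫⁻ W, ENNReal.ofReal (invWishartKernel (Ψ + R * Rᵀ) (ν + T) W) * f W ∂lebesgueSym ι := by
  rw [bayesPosterior_invWishart hΨ hν, lintegral_smul_measure,
    lintegral_withDensity_eq_lintegral_mul _ (measurable_invWishartKernel _ _).ennreal_ofReal hf]
  rfl

theorem isProbabilityMeasure_bayesPosterior_invWishart {Ψ : Matrix ι ι ℝ} {ν : ℝ} (hΨ : Ψ.PosDef)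
    (hν : (Fintype.card ι : ℝ) - 1 < ν) (R : Matrix ι (Fin T) ℝ) :
    IsProbabilityMeasure (bayesPosterior (invWishart Ψ ν) R) := by
  constructor
  obtain ⟨h0, ht⟩ := lintegral_invWishartKernel_ne_zero_and_ne_top
    (posDef_add_mul_transpose hΨ R) (ν := ν + T) (by linarith [T.cast_nonneg (α := ℝ)])
  rw [← lintegral_one, lintegral_bayesPosterior_invWishart hΨ hν R measurable_const]
  simp_rw [mul_one]
  exact ENNReal.inv_mul_cancel h0 ht

theorem isProbabilityMeasure_baseForecast_invWishart {Ψ : Matrix ι ι ℝ} {ν : ℝ} (hΨ : Ψ.PosDef)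
    (hν : (Fintype.card ι : ℝ) - 1 < ν) (R : Matrix ι (Fin T) ℝ) (m : ι → ℝ) :
    IsProbabilityMeasure (baseForecast (invWishart Ψ ν) R m) := by
  have hP := isProbabilityMeasure_bayesPosterior_invWishart hΨ hν R
  constructor
  rw [baseForecast, withDensity_apply _ MeasurableSet.univ, setLIntegral_univ]
  unfold predictiveDensity
  rw [lintegral_lintegral_swap (measurable_gaussianDensity m).ennreal_ofReal.aemeasurable]
  have hm : Measurable fun W : Matrix ι ι ℝ => ∫⁻ y, ENNReal.ofReal (gaussianDensity m W y) :=
    Measurable.lintegral_prod_left' (measurable_gaussianDensity m).ennreal_ofReal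
  rw [lintegral_bayesPosterior_invWishart hΨ hν R hm, ← measure_univ (μ := bayesPosterior
    (invWishart Ψ ν) R), ← lintegral_one, lintegral_bayesPosterior_invWishart hΨ hν R
    measurable_const]
  congr 1
  refine lintegral_congr fun W => ?_
  -- `gaussianDensity` is known to have mass 1 only for positive definite `W`; elsewhere the
  -- posterior kernel vanishes.
  by_cases hW : W.PosDef
  · rw [lintegral_gaussianDensity m hW]
  · rw [invWishartKernel_of_not_posDef _ _ hW, ENNReal.ofReal_zero, zero_mul, zero_mul]

/-- Matrix determinant lemma for a rank one update; it is the source of the t-shaped factor in the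
predictive density. -/
theorem det_add_mul_transpose_of_vec {Ψ : Matrix ι ι ℝ} (hΨ : Ψ.PosDef) (z : ι → ℝ) :
    (Ψ + (of fun i (_ : Fin 1) => z i) * (of fun i (_ : Fin 1) => z i)ᵀ).det =
      Ψ.det * (1 + z ⬝ᵥ (Ψ⁻¹ *ᵥ z)) := by
  rw [det_add_mul _ _ (isUnit_det_of_posDef hΨ), det_fin_one, Matrix.mul_assoc]
  simp [mul_apply, dotProduct, mulVec]

theorem measurable_predictiveDensity_invWishart {Ψ : Matrix ι ι ℝ} {ν : ℝ} (hΨ : Ψ.PosDef)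
    (hν : (Fintype.card ι : ℝ) - 1 < ν) (R : Matrix ι (Fin T) ℝ) (m : ι → ℝ) :
    Measurable (predictiveDensity (bayesPosterior (invWishart Ψ ν) R) m) := by
  have hP := isProbabilityMeasure_bayesPosterior_invWishart hΨ hν R
  exact Measurable.lintegral_prod_right' (measurable_gaussianDensity m).ennreal_ofReal

/-- The posterior predictive density is, up to a constant, that of a multivariate
t-distribution. -/
theorem exists_predictiveDensity_invWishart_eq {Ψ : Matrix ι ι ℝ} {ν : ℝ} (hΨ : Ψ.PosDef)
    (hν : (Fintype.card ι : ℝ) - 1 < ν) (R : Matrix ι (Fin T) ℝ) (m : ι → ℝ) :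
    ∃ k : ℝ, 0 < k ∧ ∀ y,
      predictiveDensity (bayesPosterior (invWishart Ψ ν) R) m y = ENNReal.ofReal
        (k * (1 + (y - m) ⬝ᵥ ((Ψ + R * Rᵀ)⁻¹ *ᵥ (y - m))) ^ (-(ν + T + 1) / 2)) := by
  have hT : (0 : ℝ) ≤ T := T.cast_nonneg
  have hΨ' := posDef_add_mul_transpose hΨ R
  have hd := hΨ'.det_pos
  obtain ⟨c, hc, h⟩ := exists_lintegral_invWishartKernel_eq (ι := ι) (ν := ν + T) (by linarith)
  obtain ⟨c₁, hc₁, h₁⟩ :=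
    exists_lintegral_invWishartKernel_eq (ι := ι) (ν := ν + T + 1) (by linarith)
  -- Inverse mass of the posterior kernel, times the Gaussian constant, times the part of the mass
  -- with one more residual that does not depend on `y`.
  refine ⟨(c * (Ψ + R * Rᵀ).det ^ (-(ν + T) / 2))⁻¹ *
    ((2 * Real.pi) ^ (-(Fintype.card ι : ℝ) / 2) *
      (c₁ * (Ψ + R * Rᵀ).det ^ (-(ν + T + 1) / 2))), by positivity, fun y => ?_⟩
  have hq : 0 ≤ (y - m) ⬝ᵥ ((Ψ + R * Rᵀ)⁻¹ *ᵥ (y - m)) := by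
    simpa using hΨ'.inv.posSemidef.dotProduct_mulVec_nonneg (y - m)
  rw [predictiveDensity, lintegral_bayesPosterior_invWishart hΨ hν R
    (measurable_gaussianDensity_right m y).ennreal_ofReal, h _ hΨ']
  have e : ∀ W, ENNReal.ofReal (invWishartKernel (Ψ + R * Rᵀ) (ν + T) W) *
      ENNReal.ofReal (gaussianDensity m W y) =
      ENNReal.ofReal ((2 * Real.pi) ^ (-(Fintype.card ι : ℝ) / 2)) *
        ENNReal.ofReal (invWishartKernel (Ψ + R * Rᵀ + (of fun i (_ : Fin 1) => (y - m) i) *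
          (of fun i (_ : Fin 1) => (y - m) i)ᵀ) (ν + T + 1) W) := by
    intro W
    rw [← ENNReal.ofReal_mul (invWishartKernel_nonneg _ _ _), ← ENNReal.ofReal_mul (by positivity),
      gaussianDensity_eq_likelihood, invWishartKernel_mul_likelihood, pow_one, Nat.cast_one]
  simp_rw [e]
  rw [lintegral_const_mul' _ _ ENNReal.ofReal_ne_top, h₁ _ (posDef_add_mul_transpose hΨ' _),
    det_add_mul_transpose_of_vec hΨ', ← ENNReal.ofReal_inv_of_pos (by positivity),
    ← ENNReal.ofReal_mul (by positivity), ← ENNReal.ofReal_mul (by positivity),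
    Real.mul_rpow hd.le (by positivity)]
  congr 1
  ring

end Posterior

/-! ### The multivariate t-distribution: normalization and weak continuity -/

section MultivariateT

variable {ι : Type*} [Fintype ι] [DecidableEq ι]

theorem dotProduct_inv_mulVec_nonneg {S : Matrix ι ι ℝ} (hS : S.PosDef) (x : ι → ℝ) :
    0 ≤ x ⬝ᵥ (S⁻¹ *ᵥ x) := by
  simpa using hS.inv.posSemidef.dotProduct_mulVec_nonneg x

/-- The t-law is a Gaussian scale mixture: write the negative power as a Gamma integral in `t`,
exchange the integrals, integrate the Gaussian in `x`, and a Gamma integral of shape `ν / 2`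
remains. -/
theorem lintegral_one_add_quadratic_rpow {S : Matrix ι ι ℝ} (hS : S.PosDef) {ν : ℝ} (hν : 0 < ν)
    (μ : ι → ℝ) :
    ∫⁻ x, ENNReal.ofReal
      ((1 + (x - μ) ⬝ᵥ (S⁻¹ *ᵥ (x - μ)) / ν) ^ (-(ν + Fintype.card ι) / 2)) =
    ENNReal.ofReal (Real.Gamma (ν / 2) * (ν * Real.pi) ^ ((Fintype.card ι : ℝ) / 2) *
      S.det ^ ((1 : ℝ) / 2) / Real.Gamma ((ν + Fintype.card ι) / 2)) := by
  set p : ℝ := (Fintype.card ι : ℝ) with hp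
  have hp0 : 0 ≤ p := Nat.cast_nonneg _
  have hs : 0 < (ν + p) / 2 := by positivity
  have hΓ := Real.Gamma_pos_of_pos hs
  have hd := hS.det_pos
  have e : ∀ x : ι → ℝ,
      ENNReal.ofReal ((1 + (x - μ) ⬝ᵥ (S⁻¹ *ᵥ (x - μ)) / ν) ^ (-(ν + p) / 2)) =
      ENNReal.ofReal (Real.Gamma ((ν + p) / 2))⁻¹ *
        ∫⁻ t in Set.Ioi (0 : ℝ), ENNReal.ofReal (t ^ ((ν + p) / 2 - 1) * Real.exp (-t)) *
          ENNReal.ofReal (Real.exp (-(t / ν * ((x - μ) ⬝ᵥ (S⁻¹ *ᵥ (x - μ)))))) := by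
    intro x
    have hq := dotProduct_inv_mulVec_nonneg hS (x - μ)
    set q := (x - μ) ⬝ᵥ (S⁻¹ *ᵥ (x - μ))
    have hr : 0 < 1 + q / ν := by positivity
    have h := lintegral_rpow_mul_exp_neg_mul_Ioi hs hr
    rw [setLIntegral_congr_fun (g := fun t => ENNReal.ofReal
      (t ^ ((ν + p) / 2 - 1) * Real.exp (-((1 + q / ν) * t)))) measurableSet_Ioi, h,
      ← ENNReal.ofReal_mul (by positivity), neg_div, Real.rpow_neg hr.le, one_div,
      Real.inv_rpow hr.le]
    · congr 1
      field_simp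
    · intro t ht
      have ht : 0 < t := ht
      dsimp only
      rw [← ENNReal.ofReal_mul (by positivity), mul_assoc, ← Real.exp_add]
      congr 3
      ring
  simp_rw [e]
  have hquad : Continuous fun x : ι → ℝ => (x - μ) ⬝ᵥ (S⁻¹ *ᵥ (x - μ)) := by
    fun_prop
  have hqm := hquad.measurable
  rw [lintegral_const_mul' _ _ ENNReal.ofReal_ne_top, lintegral_lintegral_swap]
  swap
  · refine Measurable.aemeasurable ?_
    have hq2 : Measurable fun p : (ι → ℝ) × ℝ => (p.1 - μ) ⬝ᵥ (S⁻¹ *ᵥ (p.1 - μ)) :=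
      hqm.comp measurable_fst
    change Measurable fun a : (ι → ℝ) × ℝ =>
      ENNReal.ofReal (a.2 ^ ((ν + p) / 2 - 1) * Real.exp (-a.2)) *
        ENNReal.ofReal (Real.exp (-(a.2 / ν * ((a.1 - μ) ⬝ᵥ (S⁻¹ *ᵥ (a.1 - μ))))))
    fun_prop
  have h2 : ∀ t ∈ Set.Ioi (0 : ℝ), ∫⁻ x : ι → ℝ,
      ENNReal.ofReal (t ^ ((ν + p) / 2 - 1) * Real.exp (-t)) *
        ENNReal.ofReal (Real.exp (-(t / ν * ((x - μ) ⬝ᵥ (S⁻¹ *ᵥ (x - μ)))))) =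
      ENNReal.ofReal ((ν * Real.pi) ^ (p / 2) * S.det ^ ((1 : ℝ) / 2)) *
        ENNReal.ofReal (t ^ (ν / 2 - 1) * Real.exp (-(1 * t))) := by
    intro t ht
    have ht : 0 < t := ht
    rw [lintegral_const_mul' _ _ ENNReal.ofReal_ne_top,
      lintegral_exp_neg_mul_quadratic hS.inv (by positivity), ← ENNReal.ofReal_mul (by positivity),
      ← ENNReal.ofReal_mul (by positivity), det_nonsing_inv, Ring.inverse_eq_inv',
      Real.inv_rpow hd.le, ← Real.rpow_neg hd.le, ← hp,
      show Real.pi / (t / ν) = ν * Real.pi * t⁻¹ by field_simp,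
      Real.mul_rpow (by positivity) (by positivity), Real.inv_rpow ht.le, ← Real.rpow_neg ht.le,
      show ν / 2 - 1 = (ν + p) / 2 - 1 + -(p / 2) by ring, Real.rpow_add ht]
    congr 1
    ring_nf
  rw [setLIntegral_congr_fun measurableSet_Ioi h2, lintegral_const_mul' _ _ ENNReal.ofReal_ne_top,
    lintegral_rpow_mul_exp_neg_mul_Ioi (half_pos hν) one_pos, ← ENNReal.ofReal_mul (by positivity),
    ← ENNReal.ofReal_mul (by positivity)]
  congr 1
  rw [div_one, Real.one_rpow]
  ring

theorem measurable_multivariateTDensity (μ : ι → ℝ) (S : Matrix ι ι ℝ) (ν : ℝ) :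
    Measurable (multivariateTDensity μ S ν) := by
  have hquad : Continuous fun x : ι → ℝ => (x - μ) ⬝ᵥ (S⁻¹ *ᵥ (x - μ)) := by
    fun_prop
  have := hquad.measurable
  unfold multivariateTDensity
  fun_prop

theorem lintegral_multivariateTDensity {S : Matrix ι ι ℝ} (hS : S.PosDef) {ν : ℝ} (hν : 0 < ν)
    (μ : ι → ℝ) : ∫⁻ x, ENNReal.ofReal (multivariateTDensity μ S ν x) = 1 := by
  have hd := hS.det_pos
  have h1 := Real.Gamma_pos_of_pos (half_pos hν)
  have h2 : 0 < Real.Gamma ((ν + Fintype.card ι) / 2) := Real.Gamma_pos_of_pos (by positivity)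
  unfold multivariateTDensity
  simp_rw [ENNReal.ofReal_mul (p := Real.Gamma ((ν + Fintype.card ι) / 2) /
      (Real.Gamma (ν / 2) * (ν * Real.pi) ^ ((Fintype.card ι : ℝ) / 2) * S.det ^ ((1 : ℝ) / 2)))
      (by positivity)]
  rw [lintegral_const_mul' _ _ ENNReal.ofReal_ne_top, lintegral_one_add_quadratic_rpow hS hν,
    ← ENNReal.ofReal_mul (by positivity), ← ENNReal.ofReal_one]
  congr 1
  field_simp

theorem isProbabilityMeasure_multivariateT {S : Matrix ι ι ℝ} (hS : S.PosDef) {ν : ℝ}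
    (hν : 0 < ν) (μ : ι → ℝ) : IsProbabilityMeasure (multivariateT μ S ν) := by
  constructor
  rw [multivariateT, withDensity_apply _ MeasurableSet.univ, setLIntegral_univ,
    lintegral_multivariateTDensity hS hν]

theorem inv_smul_of_pos {S : Matrix ι ι ℝ} (hS : S.PosDef) {c : ℝ} (hc : 0 < c) :
    (c • S)⁻¹ = c⁻¹ • S⁻¹ := by
  apply inv_eq_right_inv
  rw [smul_mul_smul_comm, mul_nonsing_inv _ (isUnit_det_of_posDef hS), mul_inv_cancel₀ hc.ne',
    one_smul]

/-- Multivariate t-distributions with proportional scale matrices are affine images of each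
other. -/
theorem multivariateT_smul_eq_map {S : Matrix ι ι ℝ} (hS : S.PosDef) (ν : ℝ) (μ : ι → ℝ)
    {c : ℝ} (hc : 0 < c) :
    multivariateT μ (c • S) ν = (multivariateT 0 S ν).map fun x => √c • x + μ := by
  have hm : Measurable fun x : ι → ℝ => √c • x + μ := by fun_prop
  have hc' : 0 < √c := Real.sqrt_pos.2 hc
  refine Measure.ext_of_lintegral _ fun f hf => ?_
  have hfm : Measurable fun x => f (√c • x + μ) := hf.comp hm
  rw [lintegral_map hf hm, multivariateT, multivariateT,
    lintegral_withDensity_eq_lintegral_mul _ (measurable_multivariateTDensity _ _ _).ennreal_ofReal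
      hf, lintegral_withDensity_eq_lintegral_mul _
      (measurable_multivariateTDensity _ _ _).ennreal_ofReal hfm]
  have hdet : ((√c • (1 : Matrix ι ι ℝ)).det) = √c ^ Fintype.card ι := by
    rw [det_smul, det_one, mul_one]
  have hG : Measurable ((fun x => ENNReal.ofReal (multivariateTDensity μ (c • S) ν x)) * f) :=
    (measurable_multivariateTDensity _ _ _).ennreal_ofReal.mul hf
  have h := lintegral_comp_mulVec (M := √c • (1 : Matrix ι ι ℝ))
    (f := fun x => ((fun x => ENNReal.ofReal (multivariateTDensity μ (c • S) ν x)) * f) (x + μ))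
    (by rw [hdet]; positivity) (hG.comp (by fun_prop))
  rw [lintegral_add_right_eq_self] at h
  have hne : ENNReal.ofReal |(√c • (1 : Matrix ι ι ℝ)).det⁻¹| ≠ 0 := by
    rw [hdet, Ne, ENNReal.ofReal_eq_zero, not_le]
    positivity
  -- Both sides are multiplied by the Jacobian of the dilation by `√c`, which reduces the claim to
  -- an identity of integrands.
  rw [← ENNReal.mul_right_inj hne ENNReal.ofReal_ne_top, ← h,
    ← lintegral_const_mul' _ _ ENNReal.ofReal_ne_top]
  refine lintegral_congr fun x => ?_
  simp only [Pi.mul_apply, smul_mulVec, one_mulVec]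
  rw [← mul_assoc, ← ENNReal.ofReal_mul (abs_nonneg _)]
  congr 2
  have hd := hS.det_pos
  rw [hdet, abs_of_pos (by positivity)]
  simp only [multivariateTDensity, add_sub_cancel_right, sub_zero, inv_smul_of_pos hS hc,
    det_smul, smul_mulVec, mulVec_smul, dotProduct_smul, smul_dotProduct, smul_eq_mul]
  rw [Real.mul_rpow (by positivity) hd.le, ← Real.rpow_pow_comm hc.le, ← Real.sqrt_eq_rpow c,
    show √c * (c⁻¹ * (√c * x ⬝ᵥ (S⁻¹ *ᵥ x))) = x ⬝ᵥ (S⁻¹ *ᵥ x) by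
      rw [mul_left_comm, ← mul_assoc (√c), Real.mul_self_sqrt hc.le,
        inv_mul_cancel_left₀ hc.ne']]
  have : √c ^ Fintype.card ι ≠ 0 := by positivity
  field_simp

/-- The multivariate t-distribution depends weakly continuously on its location and on the size of
its scale matrix. -/
theorem continuous_integral_multivariateT {F : Type*} [TopologicalSpace F]
    [FirstCountableTopology F] {S : Matrix ι ι ℝ} (hS : S.PosDef) {ν : ℝ} (hν : 0 < ν)
    {μ : F → ι → ℝ} (hμ : Continuous μ) {c : F → ℝ} (hc : Continuous c) (hc0 : ∀ w, 0 < c w)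
    (f : BoundedContinuousFunction (ι → ℝ) ℝ) :
    Continuous fun w => ∫ x, f x ∂multivariateT (μ w) (c w • S) ν := by
  have hP := isProbabilityMeasure_multivariateT hS hν 0
  have e : ∀ w, ∫ x, f x ∂multivariateT (μ w) (c w • S) ν =
      ∫ x, f (√(c w) • x + μ w) ∂multivariateT 0 S ν := by
    intro w
    rw [multivariateT_smul_eq_map hS ν _ (hc0 w),
      integral_map (by fun_prop) f.continuous.aestronglyMeasurable]
  simp_rw [e]
  -- The measure no longer depends on `w`, so dominated convergence applies with the sup norm of `f`
  -- as bound.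
  refine continuous_of_dominated (bound := fun _ => ‖f‖) (fun w => ?_) (fun w => ?_)
    (integrable_const _) ?_
  · exact (f.continuous.comp (by fun_prop)).aestronglyMeasurable
  · exact Filter.Eventually.of_forall fun x => f.norm_coe_le_norm _
  · exact Filter.Eventually.of_forall fun x => f.continuous.comp (by fun_prop)

end MultivariateT

/-! ### Conditioning on the incoherence, and the shear -/

section Conditioning

variable {nu nb : ℕ}

theorem measurable_sumElim {α β : Type*} :
    Measurable fun p : (α → ℝ) × (β → ℝ) => (Sum.elim p.1 p.2 : α ⊕ β → ℝ) := by
  refine measurable_pi_iff.2 fun i => ?_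
  rcases i with i | i
  · exact (measurable_pi_apply i).comp measurable_fst
  · exact (measurable_pi_apply i).comp measurable_snd

/-- Integration in the coordinates given by the incoherence `u - A b` and the bottom series `b`. -/
theorem lintegral_incoherence_coordinates (A : Matrix (Fin nu) (Fin nb) ℝ)
    {f : (Fin nu → ℝ) × (Fin nb → ℝ) → ℝ≥0∞} (hf : Measurable f)
    {g : (Fin nu ⊕ Fin nb → ℝ) → ℝ≥0∞} (hg : Measurable g) :
    ∫⁻ y, g y * f ((fun i => y (Sum.inl i)) - A *ᵥ (fun j => y (Sum.inr j)),
      fun j => y (Sum.inr j)) =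
    ∫⁻ w, ∫⁻ b, g (Sum.elim (A *ᵥ b + w) b) * f (w, b) := by
  have hA : Continuous fun b : Fin nb → ℝ => A *ᵥ b := by fun_prop
  have hX : Measurable fun (y : Fin nu ⊕ Fin nb → ℝ) j => y (Sum.inr j) := by fun_prop
  have hU : Measurable fun (y : Fin nu ⊕ Fin nb → ℝ) i => y (Sum.inl i) := by fun_prop
  have hm : Measurable fun y : Fin nu ⊕ Fin nb → ℝ =>
      g y * f ((fun i => y (Sum.inl i)) - A *ᵥ (fun j => y (Sum.inr j)),
        fun j => y (Sum.inr j)) :=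
    hg.mul (hf.comp ((hU.sub (hA.measurable.comp hX)).prodMk hX))
  have hm' : Measurable fun p : (Fin nu → ℝ) × (Fin nb → ℝ) =>
      g (Sum.elim p.1 p.2) * f (p.1 - A *ᵥ p.2, p.2) := hm.comp measurable_sumElim
  rw [lintegral_sum_pi hm]
  refine (lintegral_lintegral_swap hm'.aemeasurable).trans ?_
  have hm'' : Measurable fun p : (Fin nu → ℝ) × (Fin nb → ℝ) =>
      g (Sum.elim (A *ᵥ p.2 + p.1) p.2) * f (p.1, p.2) := by
    refine (hg.comp (measurable_sumElim.comp (Measurable.prodMk ?_ measurable_snd))).mul hf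
    exact (hA.measurable.comp measurable_snd).add measurable_fst
  refine Eq.trans ?_ (lintegral_lintegral_swap hm''.aemeasurable).symm
  refine lintegral_congr fun b => ?_
  -- For fixed `b`, `u = A b + w` is a translation, so no Jacobian appears.
  rw [← lintegral_add_left_eq_self _ (A *ᵥ b)]
  refine lintegral_congr fun w => ?_
  change g (Sum.elim (A *ᵥ b + w) b) * f (A *ᵥ b + w - A *ᵥ b, b) = _
  rw [add_sub_cancel_left]

/-- If the joint density factorizes, in the coordinates given by the incoherence and the bottom
series, into a positive function of the incoherence and a weakly continuous family of probability
densities, then that family is the conditional distribution. -/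
theorem isCondLawAt_of_density_factorization (A : Matrix (Fin nu) (Fin nb) ℝ)
    {g : (Fin nu ⊕ Fin nb → ℝ) → ℝ≥0∞} (hg : Measurable g)
    {H : (Fin nu → ℝ) → ℝ≥0∞} (hH : Measurable H) (hH0 : ∀ w, H w ≠ 0) (hHt : ∀ w, H w ≠ ∞)
    {τ : (Fin nu → ℝ) → (Fin nb → ℝ) → ℝ≥0∞} (hτ1 : ∀ w, ∫⁻ b, τ w b = 1)
    (hcont : ∀ f : BoundedContinuousFunction (Fin nb → ℝ) ℝ,
      Continuous fun w => ∫ b, f b ∂(volume.withDensity (τ w)))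
    (hfac : ∀ w b, g (Sum.elim (A *ᵥ b + w) b) = H w * τ w b) (z : Fin nu → ℝ) :
    IsCondLawAt (volume.withDensity g) (fun y j => y (Sum.inr j))
      (fun y => (fun i => y (Sum.inl i)) - A *ᵥ (fun j => y (Sum.inr j)))
      z (volume.withDensity (τ z)) := by
  have hA : Continuous fun b : Fin nb → ℝ => A *ᵥ b := by fun_prop
  have hX : Measurable fun (y : Fin nu ⊕ Fin nb → ℝ) j => y (Sum.inr j) := by fun_prop
  have hU : Measurable fun (y : Fin nu ⊕ Fin nb → ℝ) i => y (Sum.inl i) := by fun_prop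
  have hZ : Measurable fun y : Fin nu ⊕ Fin nb → ℝ =>
      (fun i => y (Sum.inl i)) - A *ᵥ (fun j => y (Sum.inr j)) :=
    hU.sub (hA.measurable.comp hX)
  have hτ : Measurable (Function.uncurry τ) := by
    -- Joint measurability of `τ` need not be assumed: the factorization recovers it as the quotient
    -- of `g` by `H`.
    have e : Function.uncurry τ = fun p => (H p.1)⁻¹ * g (Sum.elim (A *ᵥ p.2 + p.1) p.2) := by
      funext ⟨w, b⟩
      rw [hfac, ← mul_assoc, ENNReal.inv_mul_cancel (hH0 w) (hHt w), one_mul, Function.uncurry]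
    rw [e]
    refine (hH.comp measurable_fst).inv.mul
      (hg.comp (measurable_sumElim.comp (Measurable.prodMk ?_ measurable_snd)))
    exact (hA.measurable.comp measurable_snd).add measurable_fst
  have hτw : ∀ w, Measurable (τ w) := fun w => hτ.comp measurable_prodMk_left
  have hZlaw : (volume.withDensity g).map (fun y : Fin nu ⊕ Fin nb → ℝ =>
      (fun i => y (Sum.inl i)) - A *ᵥ (fun j => y (Sum.inr j))) = volume.withDensity H := by
    refine Measure.ext_of_lintegral _ fun f hf => ?_
    have hfZ : Measurable fun y : Fin nu ⊕ Fin nb → ℝ =>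
        f ((fun i => y (Sum.inl i)) - A *ᵥ (fun j => y (Sum.inr j))) := hf.comp hZ
    rw [lintegral_map hf hZ, lintegral_withDensity_eq_lintegral_mul _ hg hfZ,
      lintegral_withDensity_eq_lintegral_mul _ hH hf]
    refine (lintegral_incoherence_coordinates A (hf.comp measurable_fst) hg).trans ?_
    refine lintegral_congr fun w => ?_
    simp only [hfac, Function.comp_apply, Pi.mul_apply]
    rw [lintegral_mul_const _ ((hτw w).const_mul _), lintegral_const_mul _ (hτw w), hτ1, mul_one]
  let κ : Kernel (Fin nu → ℝ) (Fin nb → ℝ) := Kernel.withDensity (Kernel.const _ volume) τ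
  have hκ : ∀ w, κ w = volume.withDensity (τ w) := fun w => by
    rw [Kernel.withDensity_apply _ hτ, Kernel.const_apply]
  have hMarkov : IsMarkovKernel κ := ⟨fun w => ⟨by
    rw [hκ, withDensity_apply _ MeasurableSet.univ, setLIntegral_univ, hτ1]⟩⟩
  refine ⟨?_, κ, hMarkov, ?_, ?_, hκ z⟩
  · rw [hZlaw]
    -- `H` vanishes nowhere, so the law of the incoherence dominates Lebesgue measure and every `z`
    -- lies in its support.
    have hac : (volume : Measure (Fin nu → ℝ)) ≪ volume.withDensity H :=
      withDensity_absolutelyContinuous' hH.aemeasurable (Filter.Eventually.of_forall hH0)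
    exact hac.support_mono (by rw [Measure.support_eq_univ]; trivial)
  · intro f
    simp_rw [hκ]
    exact hcont f
  · rw [hZlaw]
    refine Measure.ext_of_lintegral _ fun f hf => ?_
    have hfZ : Measurable fun y : Fin nu ⊕ Fin nb → ℝ =>
        f ((fun i => y (Sum.inl i)) - A *ᵥ (fun j => y (Sum.inr j)), fun j => y (Sum.inr j)) :=
      hf.comp (hZ.prodMk hX)
    rw [lintegral_map hf (hZ.prodMk hX), lintegral_withDensity_eq_lintegral_mul _ hg hfZ,
      Measure.lintegral_compProd hf,
      lintegral_withDensity_eq_lintegral_mul _ hH (Measurable.lintegral_kernel_prod_right' hf)]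
    refine (lintegral_incoherence_coordinates A hf hg).trans ?_
    refine lintegral_congr fun w => ?_
    have hfw : Measurable fun b => f (w, b) := hf.comp measurable_prodMk_left
    simp only [Pi.mul_apply]
    rw [hκ, lintegral_withDensity_eq_lintegral_mul _ (hτw w) hfw,
      ← lintegral_const_mul _ ((hτw w).mul hfw)]
    refine lintegral_congr fun b => ?_
    rw [hfac, mul_assoc]
    rfl

theorem sliceLaw_of_density_factorization (A : Matrix (Fin nu) (Fin nb) ℝ)
    {g : (Fin nu ⊕ Fin nb → ℝ) → ℝ≥0∞} {h : ℝ≥0∞} (h0 : h ≠ 0) (ht : h ≠ ∞)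
    {τ : (Fin nb → ℝ) → ℝ≥0∞} (hτ : Measurable τ) (hτ1 : ∫⁻ b, τ b = 1)
    (hfac : ∀ b, g (Sum.elim (A *ᵥ b) b) = h * τ b) :
    sliceLaw A g = volume.withDensity τ := by
  unfold sliceLaw
  simp_rw [hfac]
  rw [lintegral_const_mul _ hτ, hτ1, mul_one]
  change h⁻¹ • volume.withDensity (h • τ) = _
  rw [withDensity_smul _ hτ, smul_smul, ENNReal.inv_mul_cancel h0 ht, one_smul]

/-- The shear `(u, b) ↦ (u - A b, b)`. -/
def shear (A : Matrix (Fin nu) (Fin nb) ℝ) : Matrix (Fin nu ⊕ Fin nb) (Fin nu ⊕ Fin nb) ℝ :=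
  fromBlocks 1 (-A) 0 1

theorem isUnit_shear (A : Matrix (Fin nu) (Fin nb) ℝ) : IsUnit (shear A) := by
  rw [isUnit_iff_isUnit_det, shear, det_fromBlocks_zero₂₁]
  simp

theorem posDef_shear {A : Matrix (Fin nu) (Fin nb) ℝ}
    {Ψ : Matrix (Fin nu ⊕ Fin nb) (Fin nu ⊕ Fin nb) ℝ} (hΨ : Ψ.PosDef) :
    (shear A * Ψ * (shear A)ᵀ).PosDef := by
  have := (IsUnit.posDef_star_right_conjugate_iff (isUnit_shear A)).2 hΨ
  rwa [star_eq_conjTranspose, conjTranspose_eq_transpose_of_trivial] at this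

theorem dotProduct_inv_shear (A : Matrix (Fin nu) (Fin nb) ℝ)
    (Ψ : Matrix (Fin nu ⊕ Fin nb) (Fin nu ⊕ Fin nb) ℝ) (z : Fin nu ⊕ Fin nb → ℝ) :
    (shear A *ᵥ z) ⬝ᵥ ((shear A * Ψ * (shear A)ᵀ)⁻¹ *ᵥ (shear A *ᵥ z)) = z ⬝ᵥ (Ψ⁻¹ *ᵥ z) := by
  have hu := (isUnit_iff_isUnit_det _).1 (isUnit_shear A)
  have hu' : IsUnit (shear A)ᵀ.det := by rwa [det_transpose]
  rw [Matrix.mul_inv_rev, Matrix.mul_inv_rev, mulVec_mulVec, ← vecMul_transpose (shear A) z, ← dotProduct_mulVec,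
    mulVec_mulVec, ← Matrix.mul_assoc, mul_nonsing_inv_cancel_left _ _ hu',
    nonsing_inv_mul_cancel_right _ _ hu]

/-- If `Ψ` is the scale of `(U, B)`, this is the scale of `(U - A B, B)`: the corner is `Q`, and `Vᵀ
- W * Aᵀ` is the cross term between `B` and the incoherence. -/
theorem shear_conj_eq (A : Matrix (Fin nu) (Fin nb) ℝ) (U : Matrix (Fin nu) (Fin nu) ℝ)
    (V : Matrix (Fin nu) (Fin nb) ℝ) (W : Matrix (Fin nb) (Fin nb) ℝ) (hW : Wᵀ = W) :
    shear A * fromBlocks U V Vᵀ W * (shear A)ᵀ =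
      fromBlocks (U - V * Aᵀ - A * Vᵀ + A * W * Aᵀ) (Vᵀ - W * Aᵀ)ᵀ (Vᵀ - W * Aᵀ) W := by
  rw [shear, fromBlocks_transpose, fromBlocks_multiply, fromBlocks_multiply]
  congr 1
  · simp [Matrix.add_mul, Matrix.mul_assoc]
    abel
  · simp [hW, sub_eq_add_neg]
  · simp [sub_eq_add_neg]
  · simp

end Conditioning

/-! ### Slices of the predictive density and the reconciled distribution -/

section Reconciliation

/-- Renormalization of a power of a quadratic polynomial to a multivariate t-density. -/
theorem rpow_quadratic_eq_mul_multivariateTDensity {ι : Type*} [Fintype ι] [DecidableEq ι]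
    {S : Matrix ι ι ℝ} (hS : S.PosDef) {ν c : ℝ} (hν : 0 < ν) (hc : 0 < c) (μ x : ι → ℝ) :
    (c + (x - μ) ⬝ᵥ (S⁻¹ *ᵥ (x - μ))) ^ (-(ν + Fintype.card ι) / 2) =
      (c ^ (-(ν + Fintype.card ι) / 2) * (Real.Gamma (ν / 2) *
        (ν * Real.pi) ^ ((Fintype.card ι : ℝ) / 2) * ((c / ν) • S).det ^ ((1 : ℝ) / 2) /
          Real.Gamma ((ν + Fintype.card ι) / 2))) *
        multivariateTDensity μ ((c / ν) • S) ν x := by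
  have hcν : 0 < c / ν := div_pos hc hν
  have hd := (hS.smul hcν).det_pos
  have h1 := Real.Gamma_pos_of_pos (half_pos hν)
  have h2 : 0 < Real.Gamma ((ν + Fintype.card ι) / 2) := Real.Gamma_pos_of_pos (by positivity)
  have hq := dotProduct_inv_mulVec_nonneg hS (x - μ)
  rw [multivariateTDensity, inv_smul_of_pos hS hcν, smul_mulVec, dotProduct_smul, smul_eq_mul]
  set q := (x - μ) ⬝ᵥ (S⁻¹ *ᵥ (x - μ))
  -- Pulling out `c` leaves `1 + q / c`; rescaling `S` by `c / ν` turns this into the standard form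
  -- with its division by `ν`.
  have e : c + q = c * (1 + (c / ν)⁻¹ * q / ν) := by field_simp
  rw [e, Real.mul_rpow hc.le (by positivity)]
  field_simp

/-- The shear sends `y - ŷ` to `(d + w, b - b̂)`, with `d` the vector `A *ᵥ bhat - uhat`, and
completing the square gives the regression of the second block on the first. The double transposes
fit the pattern `fromBlocks D B Bᵀ _` with `B = Hᵀ`. -/
theorem dotProduct_inv_coherent {nu nb : ℕ} (A : Matrix (Fin nu) (Fin nb) ℝ)
    {Q : Matrix (Fin nu) (Fin nu) ℝ} {H : Matrix (Fin nb) (Fin nu) ℝ}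
    {S : Matrix (Fin nb) (Fin nb) ℝ} {Ψ : Matrix (Fin nu ⊕ Fin nb) (Fin nu ⊕ Fin nb) ℝ}
    (hQ : Q.PosDef) (hS : S.PosDef)
    (hΨ : shear A * Ψ * (shear A)ᵀ = fromBlocks Q Hᵀ Hᵀᵀ (S + Hᵀᵀ * Q⁻¹ * Hᵀ))
    (uhat w : Fin nu → ℝ) (bhat b : Fin nb → ℝ) :
    (Sum.elim (A *ᵥ b + w) b - Sum.elim uhat bhat) ⬝ᵥ
        (Ψ⁻¹ *ᵥ (Sum.elim (A *ᵥ b + w) b - Sum.elim uhat bhat)) =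
      (A *ᵥ bhat - uhat + w) ⬝ᵥ (Q⁻¹ *ᵥ (A *ᵥ bhat - uhat + w)) +
        (b - (bhat + (H * Q⁻¹) *ᵥ (A *ᵥ bhat - uhat + w))) ⬝ᵥ
          (S⁻¹ *ᵥ (b - (bhat + (H * Q⁻¹) *ᵥ (A *ᵥ bhat - uhat + w)))) := by
  have hz : shear A *ᵥ (Sum.elim (A *ᵥ b + w) b - Sum.elim uhat bhat) =
      Sum.elim (A *ᵥ bhat - uhat + w) (b - bhat) := by
    rw [← Sum.elim_sub_sub, shear, fromBlocks_mulVec]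
    simp only [Sum.elim_comp_inl, Sum.elim_comp_inr, one_mulVec, zero_mulVec,
      neg_mulVec, mulVec_sub]
    congr 1 <;> abel
  rw [← dotProduct_inv_shear A, hz, hΨ, dotProduct_inv_fromBlocks_schur hQ _ hS,
    transpose_transpose, sub_sub]

end Reconciliation

end HierRec

open HierRec
theorem theorem1
    (nu nb T : ℕ)
    (A : Matrix (Fin nu) (Fin nb) ℝ)
    (Ψ₀ : Matrix (Fin nu ⊕ Fin nb) (Fin nu ⊕ Fin nb) ℝ) (ν₀ : ℝ)
    (hΨ₀ : Ψ₀.PosDef) (hν₀ : ((nu + nb : ℕ) : ℝ) - 1 < ν₀)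
    (R : Matrix (Fin nu ⊕ Fin nb) (Fin T) ℝ)
    (uhat : Fin nu → ℝ) (bhat : Fin nb → ℝ)
    -- posterior parameters and blocks of the posterior scale matrix
    (Ψ' : Matrix (Fin nu ⊕ Fin nb) (Fin nu ⊕ Fin nb) ℝ) (hΨ' : Ψ' = Ψ₀ + R * Rᵀ)
    (ν' : ℝ) (hν' : ν' = ν₀ + T)
    (ΨU : Matrix (Fin nu) (Fin nu) ℝ) (hΨU : ΨU = Ψ'.toBlocks₁₁)
    (ΨUB : Matrix (Fin nu) (Fin nb) ℝ) (hΨUB : ΨUB = Ψ'.toBlocks₁₂)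
    (ΨB : Matrix (Fin nb) (Fin nb) ℝ) (hΨB : ΨB = Ψ'.toBlocks₂₂)
    -- parameters of the reconciled distribution
    (Q : Matrix (Fin nu) (Fin nu) ℝ)
    (hQ : Q = ΨU - ΨUB * Aᵀ - A * ΨUBᵀ + A * ΨB * Aᵀ)
    (d : Fin nu → ℝ) (hd : d = A *ᵥ bhat - uhat)
    (νt : ℝ) (hνt : νt = ν' - nb + 1)
    (C : ℝ) (hC : C = (1 + d ⬝ᵥ (Q⁻¹ *ᵥ d)) / νt)
    (bt : Fin nb → ℝ) (hbt : bt = bhat + ((ΨUBᵀ - ΨB * Aᵀ) * Q⁻¹) *ᵥ d)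
    (St : Matrix (Fin nb) (Fin nb) ℝ)
    (hSt : St = C • (ΨB - (ΨUBᵀ - ΨB * Aᵀ) * Q⁻¹ * (ΨUBᵀ - ΨB * Aᵀ)ᵀ)) :
    -- all the parameters are admissible and the base forecast distribution is proper
    Q.PosDef ∧ St.PosDef ∧ 0 < νt ∧
    IsProbabilityMeasure (baseForecast (invWishart Ψ₀ ν₀) R (Sum.elim uhat bhat)) ∧
    -- the conditional distribution of the bottom series given coherence
    IsCondLawAt (baseForecast (invWishart Ψ₀ ν₀) R (Sum.elim uhat bhat))
      (fun y j => y (Sum.inr j))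
      (fun y => (fun i => y (Sum.inl i)) - A *ᵥ (fun j => y (Sum.inr j)))
      0 (multivariateT bt St νt) ∧
    -- equivalently, the base forecast density sliced over the coherent subspace
    sliceLaw A (predictiveDensity (bayesPosterior (invWishart Ψ₀ ν₀) R) (Sum.elim uhat bhat)) =
      multivariateT bt St νt := by
  have hcard : (Fintype.card (Fin nu ⊕ Fin nb) : ℝ) - 1 < ν₀ := by simpa using hν₀
  have hΨ'pd : Ψ'.PosDef := hΨ' ▸ posDef_add_mul_transpose hΨ₀ R
  have hνt0 : 0 < νt := by
    have h1 : (0 : ℝ) ≤ T := T.cast_nonneg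
    have h2 : (0 : ℝ) ≤ nu := nu.cast_nonneg
    push_cast at hν₀
    linarith
  have hBsymm : ΨBᵀ = ΨB := by
    rw [hΨB]
    exact isSymm_of_posDef (hΨ'pd.submatrix (e := Sum.inr) Sum.inr_injective)
  have h21 : Ψ'.toBlocks₂₁ = Ψ'.toBlocks₁₂ᵀ := by
    ext i j
    exact (congrFun (congrFun (isSymm_of_posDef hΨ'pd) (Sum.inr i)) (Sum.inl j)).symm
  have hblocks : Ψ' = fromBlocks ΨU ΨUB ΨUBᵀ ΨB := by
    rw [hΨU, hΨUB, hΨB, ← h21, fromBlocks_toBlocks]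
  set H : Matrix (Fin nb) (Fin nu) ℝ := ΨUBᵀ - ΨB * Aᵀ with hH
  set S : Matrix (Fin nb) (Fin nb) ℝ := ΨB - H * Q⁻¹ * Hᵀ with hS
  have hshear : shear A * Ψ' * (shear A)ᵀ = fromBlocks Q Hᵀ Hᵀᵀ (S + Hᵀᵀ * Q⁻¹ * Hᵀ) := by
    rw [hblocks, shear_conj_eq A ΨU ΨUB ΨB hBsymm, ← hQ, ← hH, transpose_transpose, hS,
      sub_add_cancel]
  have hpd : (fromBlocks Q Hᵀ Hᵀᵀ (S + Hᵀᵀ * Q⁻¹ * Hᵀ)).PosDef := hshear ▸ posDef_shear hΨ'pd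
  have hQpd : Q.PosDef := hpd.submatrix (e := Sum.inl) Sum.inl_injective
  have hSpd : S.PosDef := (posDef_fromBlocks_schur_iff hQpd _ _).1 hpd
  -- Slice parameters at incoherence `w`; at `w = 0` they give `c 0 / νt = C` and `μ 0 = bt`.
  let c : (Fin nu → ℝ) → ℝ := fun w => 1 + (d + w) ⬝ᵥ (Q⁻¹ *ᵥ (d + w))
  let μ : (Fin nu → ℝ) → Fin nb → ℝ := fun w => bhat + (H * Q⁻¹) *ᵥ (d + w)
  have hc0 : ∀ w, 0 < c w := fun w =>
    add_pos_of_pos_of_nonneg one_pos (dotProduct_inv_mulVec_nonneg hQpd _)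
  have hcc : Continuous c := by fun_prop
  have hμc : Continuous μ := by fun_prop
  have hc0' : c 0 / νt = C := by simp [c, hC]
  have hSt' : St = (c 0 / νt) • S := by rw [hSt, hc0']
  have hμ0 : μ 0 = bt := by simp [μ, hbt]
  have hscale : ∀ w, ((c w / νt) • S).PosDef := fun w => hSpd.smul (div_pos (hc0 w) hνt0)
  have hprob := isProbabilityMeasure_baseForecast_invWishart hΨ₀ hcard R (Sum.elim uhat bhat)
  obtain ⟨k, hk, hpred⟩ :=
    exists_predictiveDensity_invWishart_eq hΨ₀ hcard R (Sum.elim uhat bhat)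
  have hgm := measurable_predictiveDensity_invWishart hΨ₀ hcard R (Sum.elim uhat bhat)
  -- `η` gathers what in the slice at `w` does not depend on `b`: up to a constant, the density of
  -- the incoherence.
  let η : (Fin nu → ℝ) → ℝ := fun w => k * (c w ^ (-(νt + nb) / 2) * (Real.Gamma (νt / 2) *
    (νt * Real.pi) ^ ((nb : ℝ) / 2) * ((c w / νt) • S).det ^ ((1 : ℝ) / 2) /
      Real.Gamma ((νt + nb) / 2)))
  have hη0 : ∀ w, 0 < η w := fun w => by
    have h1 := Real.Gamma_pos_of_pos (half_pos hνt0)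
    have h2 : 0 < Real.Gamma ((νt + nb) / 2) := Real.Gamma_pos_of_pos (by positivity)
    have h3 := (hscale w).det_pos
    have h4 := hc0 w
    positivity
  have hηm : Measurable η := by
    have := hcc.measurable
    simp only [η, det_smul]
    fun_prop
  let τ : (Fin nu → ℝ) → (Fin nb → ℝ) → ℝ≥0∞ := fun w b =>
    ENNReal.ofReal (multivariateTDensity (μ w) ((c w / νt) • S) νt b)
  have hτ1 : ∀ w, ∫⁻ b, τ w b = 1 := fun w => lintegral_multivariateTDensity (hscale w) hνt0 _
  have hfac : ∀ w b, predictiveDensity (bayesPosterior (invWishart Ψ₀ ν₀) R) (Sum.elim uhat bhat)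
      (Sum.elim (A *ᵥ b + w) b) = ENNReal.ofReal (η w) * τ w b := by
    intro w b
    have h := rpow_quadratic_eq_mul_multivariateTDensity hSpd hνt0 (hc0 w) (μ w) b
    rw [Fintype.card_fin] at h
    rw [hpred, ← hΨ', dotProduct_inv_coherent A hQpd hSpd hshear, ← hd, ← add_assoc,
      -- This identity of exponents is what forces `νt = ν' - nb + 1`.
      show -(ν₀ + T + 1) / 2 = -(νt + nb) / 2 by rw [hνt, hν']; ring,
      ← ENNReal.ofReal_mul (hη0 w).le]
    congr 1
    rw [mul_assoc]
    exact congrArg (k * ·) h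
  have hτ0 : volume.withDensity (τ 0) = multivariateT bt St νt := by
    simp only [τ, hμ0, ← hSt', multivariateT]
  refine ⟨hQpd, hSt' ▸ hscale 0, hνt0, hprob, ?_, ?_⟩
  · rw [← hτ0]
    exact isCondLawAt_of_density_factorization A hgm hηm.ennreal_ofReal
      (fun w => by simpa using hη0 w) (fun w => ENNReal.ofReal_ne_top) hτ1
      (continuous_integral_multivariateT hSpd hνt0 hμc (hcc.div_const νt)
        fun w => div_pos (hc0 w) hνt0) hfac 0
  · rw [← hτ0]
    exact sliceLaw_of_density_factorization A (by simpa using hη0 0) ENNReal.ofReal_ne_top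
      (measurable_multivariateTDensity _ _ _).ennreal_ofReal (hτ1 0)
      fun b => by simpa using hfac 0 b
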